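/- **Binary model.** A random series-parallel network of size $n \ge 1$ (a directed multigraph with $n$ labelled edges) is generated as follows. In step $1$ there is a single edge, labelled $1$, from the source to the sink. In step $n > 1$ one of the $n-1$ edges $j = (x,y)$ of the current network is chosen uniformly at random. If the node $x$ has out-degree $1$, then an additional edge $(x,y)$ labelled $n$ is inserted; otherwise (i.e. $x$ has out-degree $2$) the edge $j=(x,y)$ is replaced by the two edges $(x,z)$, labelled $j$, and $(z,y)$, labelled $n$, where $z$ is a new node. A random path in such a network starts at the source and, in each node, follows one of the outgoing edges chosen uniformly at random (parallel edges being distinct), until it arrives at the sink. **Theorem.** Let $L_n$ be the length (number of edges) of a random path from source to sink in a random series-parallel network of size $n$ generated by the binary model, and let $\phi = \frac{\sqrt5-1}{2}$. Then for all $n \ge 1$ $$\mathbb{E}(L_{n}) = n \left(\frac{3+\sqrt{5}}{2 \sqrt{5}} \binom{n+\frac{\sqrt{5}}{2}-\frac{3}{2}}{n} - \frac{3-\sqrt{5}}{2 \sqrt{5}} \binom{n-\frac{\sqrt{5}}{2} - \frac{3}{2}}{n}\right),$$ where $\binom{x}{n} = \frac{x(x-1)\cdots(x-n+1)}{n!}$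 for real $x$, and, as $n \to \infty$, $$\mathbb{E}(L_n) \sim \frac{3+\sqrt{5}}{2 \sqrt{5}}\, \frac{n^{\phi}}{\Gamma(\phi)}.$$ Moreover, $L_n / n^{\phi}$ converges in distribution, as $n \to \infty$, to a random variable $L$ whose integer moments all exist and are given by $$\mathbb{E}(L^{r}) = \frac{r!\, c_{r}}{\Gamma(r \phi +1)}, \qquad r \ge 0,$$ where $c_0 = 1$, $c_1 = \frac{3+\phi}{5}$ and $$c_{r} = \frac{1}{(r-1) \phi\, ((r+1)\phi+1)} \sum_{k=1}^{r-1} (k\phi+1)\, c_{k}\, c_{r-k}, \qquad r \ge 2;$$ and the law of $L$ is characterized by these moments, i.e. it is the only probability measure on $\mathbb{R}$ with these moments. -/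

import Mathlib

open MeasureTheory ProbabilityTheory Filter Topology Asymptotics

namespace BinarySaturation

/-- A network with `n` edges (a directed multigraph with labelled edges): the edge `e` leads from
the node `(G e).1` to the node `(G e).2`. The index `e : Fin n` is the label `e + 1`. -/
abbrev Network (n : ℕ) : Type := Fin n → ℕ × ℕ

/-- The node that is the source of every network. -/
def source : ℕ := 0

/-- The node that is the sink of every network. -/
def sink : ℕ := 1

/-- The edges leaving the node `x`; their number is the out-degree of `x`. -/
def outEdges {n : ℕ} (G : Network n) (x : ℕ) : Finset (Fin n) :=
  Finset.univ.filter fun e => (G e).1 = x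

/-- Add one edge in parallel to the edge `j = (x, y)`. -/
def parallelDouble {n : ℕ} (G : Network n) (j : Fin n) : Network (n + 1) :=
  Fin.snoc (α := fun _ => ℕ × ℕ) G (G j)

/-- Replace the edge `j = (x, y)` by `(x, z)`, which keeps the label `j`, and the new edge
`(z, y)`. The new node `z` is called `n + 1`: a network grown to size `n` uses only the
nodes `0, …, n`. -/
def serialDouble {n : ℕ} (G : Network n) (j : Fin n) : Network (n + 1) :=
  Fin.snoc (α := fun _ => ℕ × ℕ) (Function.update G j ((G j).1, n + 1)) (n + 1, (G j).2)

/-- One growth step at the chosen edge `j = (x, y)`: a parallel doubling if `x` has out-degree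
one, a serial doubling otherwise. -/
def grow {n : ℕ} (G : Network n) (j : Fin n) : Network (n + 1) :=
  if (outEdges G (G j).1).card = 1 then parallelDouble G j else serialDouble G j

/-- The random network of size `n` in the binary model: the network of size one is a single edge
from the source to the sink, and in each further step an edge is chosen uniformly at random and
doubled by `grow`. (The size zero is a dummy.) -/
noncomputable def networkLaw : (n : ℕ) → PMF (Network n)
  | 0 => PMF.pure Fin.elim0
  | 1 => PMF.pure fun _ => (source, sink)
  | n + 2 => (networkLaw (n + 1)).bind fun G =>
      (PMF.uniformOfFintype (Fin (n + 1))).map (grow G)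

/-- The list of edges traversed by the random walk started in `x` in its first `k` steps: in each
node other than the sink one of the outgoing edges is chosen uniformly at random and followed,
in the sink the walk stops. -/
noncomputable def walk {n : ℕ} (G : Network n) : ℕ → ℕ → PMF (List (Fin n))
  | 0, _ => PMF.pure []
  | k + 1, x =>
    if h : x ≠ sink ∧ (outEdges G x).Nonempty then
      (PMF.uniformOfFinset (outEdges G x) h.2).bind fun e =>
        (walk G k (G e).2).map (List.cons e)
    else PMF.pure []

/-- The random path from the source to the sink of a network of size `n`. The walk is run for `n`
steps; by `randomPath_isPath` below it has arrived at the sink by then. -/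
noncomputable def randomPath {n : ℕ} (G : Network n) : PMF (List (Fin n)) :=
  walk G n source

/-- The law of `L_n`, the number of edges of a random source-to-sink path in a random network of
size `n`. -/
noncomputable def pathLengthLaw (n : ℕ) : PMF ℕ :=
  (networkLaw n).bind fun G => (randomPath G).map List.length

/-- The list of edges `p` is a directed path from `x` to `y`. -/
def IsPath {n : ℕ} (G : Network n) : ℕ → List (Fin n) → ℕ → Prop
  | x, [], y => x = y
  | x, e :: p, y => (G e).1 = x ∧ IsPath G (G e).2 p y

/-- `r` decreases along the edges, every node on an edge except for the sink has an outgoing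
edge, and the nodes on the edges are at most `n`. -/
structure Ranked {n : ℕ} (G : Network n) (r : ℕ → ℕ) : Prop where
  lt : ∀ e, r (G e).2 < r (G e).1
  out : ∀ e, (G e).2 ≠ sink → (outEdges G (G e).2).Nonempty
  out_source : (outEdges G source).Nonempty
  fst_le : ∀ e, (G e).1 ≤ n
  snd_le : ∀ e, (G e).2 ≤ n
  bound : ∀ x, r x ≤ n

theorem outEdges_nonempty {n : ℕ} {G : Network n} {x : ℕ} :
    (outEdges G x).Nonempty ↔ ∃ e, (G e).1 = x := by
  simp [outEdges, Finset.Nonempty]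

theorem Ranked.grow {n : ℕ} {G : Network n} {r : ℕ → ℕ} (h : Ranked G r) (j : Fin n) :
    ∃ r', Ranked (grow G j) r' := by
  unfold BinarySaturation.grow
  split_ifs
  · have key : ∀ x, (outEdges G x).Nonempty → (outEdges (parallelDouble G j) x).Nonempty := by
      intro x
      rw [outEdges_nonempty, outEdges_nonempty]
      rintro ⟨e, he⟩
      exact ⟨e.castSucc, by simpa [parallelDouble] using he⟩
    refine ⟨r, ?_, ?_, key _ h.out_source, ?_, ?_, fun x => (h.bound x).trans n.le_succ⟩
    · intro e
      induction e using Fin.lastCases <;> simp [parallelDouble, h.lt]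
    · intro e he
      apply key
      induction e using Fin.lastCases with
      | last => simp only [parallelDouble, Fin.snoc_last] at he ⊢; exact h.out _ he
      | cast e => simp only [parallelDouble, Fin.snoc_castSucc] at he ⊢; exact h.out _ he
    · intro e
      induction e using Fin.lastCases <;> simp [parallelDouble, (h.fst_le _).trans n.le_succ]
    · intro e
      induction e using Fin.lastCases <;> simp [parallelDouble, (h.snd_le _).trans n.le_succ]
  · have key : ∀ x, (outEdges G x).Nonempty → (outEdges (serialDouble G j) x).Nonempty := by
      intro x
      rw [outEdges_nonempty, outEdges_nonempty]
      rintro ⟨e, he⟩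
      refine ⟨e.castSucc, ?_⟩
      by_cases hj : e = j
      · subst hj; simpa [serialDouble] using he
      · simpa [serialDouble, hj] using he
    have hz : (outEdges (serialDouble G j) (n + 1)).Nonempty :=
      outEdges_nonempty.2 ⟨Fin.last n, by simp [serialDouble]⟩
    have hne1 : ∀ e, (G e).1 ≠ n + 1 := fun e => by have := h.fst_le e; omega
    have hne2 : ∀ e, (G e).2 ≠ n + 1 := fun e => by have := h.snd_le e; omega
    refine ⟨fun x => if x = n + 1 then r (G j).2 + 1 else
      if r (G j).2 < r x then r x + 1 else r x, ?_, ?_, key _ h.out_source, ?_, ?_, ?_⟩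
    · intro e
      induction e using Fin.lastCases with
      | last => simp [serialDouble, hne2]
      | cast e =>
        by_cases hj : e = j
        · subst hj
          have := h.lt e
          simp [serialDouble, hne1, this]
        · have := h.lt e
          simp only [serialDouble, Fin.snoc_castSucc, Function.update_of_ne hj, hne1, hne2,
            if_false]
          split_ifs <;> omega
    · intro e he
      induction e using Fin.lastCases with
      | last => simp only [serialDouble, Fin.snoc_last] at he ⊢; exact key _ (h.out _ he)
      | cast e =>
        by_cases hj : e = j
        · subst hj
          simpa [serialDouble] using hz
        · simp only [serialDouble, Fin.snoc_castSucc, Function.update_of_ne hj] at he ⊢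
          exact key _ (h.out _ he)
    · intro e
      induction e using Fin.lastCases with
      | last => simp [serialDouble]
      | cast e =>
        by_cases hj : e = j
        · subst hj; simpa [serialDouble] using (h.fst_le e).trans n.le_succ
        · simpa [serialDouble, hj] using (h.fst_le e).trans n.le_succ
    · intro e
      induction e using Fin.lastCases with
      | last => simpa [serialDouble] using (h.snd_le j).trans n.le_succ
      | cast e =>
        by_cases hj : e = j
        · subst hj; simp [serialDouble]
        · simpa [serialDouble, hj] using (h.snd_le e).trans n.le_succ
    · intro x
      have h1 := h.bound x
      have h2 := h.bound (G j).2
      split_ifs <;> omega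

theorem exists_ranked : ∀ n : ℕ, ∀ G ∈ (networkLaw (n + 1)).support, ∃ r, Ranked G r := by
  intro n
  induction n with
  | zero =>
    intro G hG
    simp only [networkLaw, PMF.support_pure, Set.mem_singleton_iff] at hG
    subst hG
    refine ⟨fun x => if x = source then 1 else 0, ?_, ?_, ?_, ?_, ?_, ?_⟩
    · simp [source, sink]
    · simp
    · exact outEdges_nonempty.2 ⟨0, rfl⟩
    · simp [source]
    · simp [sink]
    · intro x; split_ifs <;> simp
  | succ n ih =>
    intro G hG
    simp only [networkLaw, PMF.mem_support_bind_iff, PMF.mem_support_map_iff] at hG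
    obtain ⟨G', hG', j, -, rfl⟩ := hG
    obtain ⟨r, hr⟩ := ih G' hG'
    exact hr.grow j

theorem Ranked.walk_isPath {n : ℕ} {G : Network n} {r : ℕ → ℕ} (h : Ranked G r) :
    ∀ k x, r x ≤ k → (x ≠ sink → (outEdges G x).Nonempty) →
      ∀ p ∈ (walk G k x).support, IsPath G x p sink := by
  intro k
  induction k with
  | zero =>
    intro x hx ho p hp
    simp only [walk, PMF.support_pure, Set.mem_singleton_iff] at hp
    subst hp
    by_contra hxs
    obtain ⟨e, he⟩ := outEdges_nonempty.1 (ho hxs)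
    have := h.lt e
    rw [he] at this
    omega
  | succ k ih =>
    intro x hx ho p hp
    by_cases hxs : x = sink
    · rw [walk, dif_neg (by simp [hxs])] at hp
      simp only [PMF.support_pure, Set.mem_singleton_iff] at hp
      subst hp
      exact hxs
    · rw [walk, dif_pos ⟨hxs, ho hxs⟩] at hp
      simp only [PMF.mem_support_bind_iff, PMF.mem_support_map_iff,
        PMF.mem_support_uniformOfFinset_iff] at hp
      obtain ⟨e, he, q, hq, rfl⟩ := hp
      have he' : (G e).1 = x := by simpa [outEdges] using he
      have := h.lt e
      rw [he'] at this
      exact ⟨he', ih _ (by omega) (h.out e) q hq⟩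

/-- In every network of the binary model the random path ends in the sink. -/
theorem randomPath_isPath {n : ℕ} (hn : 1 ≤ n) {G : Network n} (hG : G ∈ (networkLaw n).support)
    {p : List (Fin n)} (hp : p ∈ (randomPath G).support) : IsPath G source p sink := by
  obtain ⟨m, rfl⟩ : ∃ m, n = m + 1 := ⟨n - 1, by omega⟩
  obtain ⟨r, hr⟩ := exists_ranked m G hG
  exact hr.walk_isPath _ _ (hr.bound _) (fun _ => hr.out_source) p hp

/-- The exponent `φ = (√5 - 1) / 2`. -/
noncomputable def phi : ℝ := (√5 - 1) / 2

end BinarySaturation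

open BinarySaturation

/-! Split the edges of a random path into two types: sole edge leaving its first node, or not. Let a
and b be their numbers. Choosing an edge of the first type turns it into one of the second type, so
(a, b) becomes (a - 1, b + 1); choosing an edge of the second type keeps it and adds one of the
first type, so (a, b) becomes (a + 1, b); edges off the path have no effect. With n equally likely
edges this gives E_{n+1} g = E_n [g + A g / n], where A is the `generator` of a two-type branching
process (`ev_urnLaw_succ`).

On monomials C^a D^b the operator A is the derivation C ↦ D - C, D ↦ C D - D. If power series
satisfy φ s C' = D - C and φ s D' = C D - D, then A acts on C(s)^a D(s)^b as φ s d/ds, so the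
coefficient of s^r is an eigenfunction of A for the eigenvalue r φ. Comparing coefficients for C = ∑
c_r s^r gives exactly the recursion of the c_r, with c_1 free. The eigenfunction for r has
expectation c_r ∏ (1 + r φ / k), the product over k < n. The given c_1 is the one for which a + b is
the linear eigenfunction for φ plus a multiple of the one for -(1 + φ); this yields the mean.

For s = θ / n^φ, dominated convergence gives E C(s)^a D(s)^b → M(θ) = ∑ c_r θ^r / Γ(r φ + 1)
(`tendsto_scaledGen`). Both C and D agree with exponentials up to O(s²), so M(iξ) is also the
limiting characteristic function of the scaled main eigenfunction (`tendsto_exp_mainPart`). The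
minor one has second moment O(n^φ) and vanishes after division by n^φ. Since M is an entire series,
convergence in law, the moments of the limit and their uniqueness all follow from characteristic
functions. -/

namespace PMF

/-! ### Expectations under finitely supported laws -/

variable {α β γ : Type*} {E : Type*} [NormedAddCommGroup E] [NormedSpace ℝ E]

theorem bind_congr_of_support {p : PMF α} {f g : α → PMF β} (h : ∀ a ∈ p.support, f a = g a) :
    p.bind f = p.bind g := by
  ext b
  simp only [bind_apply]
  refine tsum_congr fun a => ?_
  by_cases ha : p a = 0
  · simp [ha]
  · rw [h a ha]

theorem uniformOfFinset_bind_apply (s : Finset α) (hs : s.Nonempty) (f : α → PMF β) (b : β) :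
    (uniformOfFinset s hs).bind f b = (s.card : ENNReal)⁻¹ * ∑ a ∈ s, f a b := by
  rw [bind_apply, tsum_eq_sum (s := s), Finset.mul_sum]
  · refine Finset.sum_congr rfl fun a ha => ?_
    rw [uniformOfFinset_apply_of_mem hs ha]
  · intro a ha
    rw [uniformOfFinset_apply_of_notMem hs ha, zero_mul]

theorem finite_support_bind {p : PMF α} {f : α → PMF β} (hp : p.support.Finite)
    (hf : ∀ a ∈ p.support, (f a).support.Finite) : (p.bind f).support.Finite := by
  rw [support_bind]
  exact hp.biUnion hf

theorem finite_support_map {p : PMF α} (f : α → β) (hp : p.support.Finite) :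
    (p.map f).support.Finite := by
  rw [support_map]
  exact hp.image f

/-- The expectation of `g` under a probability mass function. -/
noncomputable def ev (p : PMF α) (g : α → E) : E := ∑' x, (p x).toReal • g x

theorem ev_eq_sum {p : PMF α} {s : Finset α} (hs : p.support ⊆ s) (g : α → E) :
    p.ev g = ∑ x ∈ s, (p x).toReal • g x := by
  refine tsum_eq_sum fun x hx => ?_
  have : p x = 0 := by
    by_contra h
    exact hx (hs h)
  simp [this]

theorem ev_congr {p : PMF α} {f g : α → E} (h : ∀ a ∈ p.support, f a = g a) : p.ev f = p.ev g := by
  refine tsum_congr fun a => ?_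
  by_cases ha : p a = 0
  · simp [ha]
  · rw [h a ha]

theorem ev_pure (a : α) (g : α → E) : (pure a).ev g = g a := by
  classical
  rw [ev_eq_sum (s := {a}) (by simp)]
  simp

theorem ev_bind {p : PMF α} {f : α → PMF β} (hp : p.support.Finite)
    (hf : ∀ a ∈ p.support, (f a).support.Finite) (g : β → E) :
    (p.bind f).ev g = p.ev fun a => (f a).ev g := by
  have h1 := finite_support_bind hp hf
  rw [ev_eq_sum (s := h1.toFinset) (by simp), ev_eq_sum (s := hp.toFinset) (by simp)]
  have h2 : ∀ a ∈ hp.toFinset, (p a).toReal • (f a).ev g =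
      ∑ b ∈ h1.toFinset, ((p a).toReal * (f a b).toReal) • g b := by
    intro a ha
    rw [ev_eq_sum (s := h1.toFinset), Finset.smul_sum]
    · simp only [mul_smul]
    · intro b hb
      rw [Set.Finite.coe_toFinset, support_bind]
      exact Set.mem_biUnion ((Set.Finite.mem_toFinset hp).1 ha) hb
  rw [Finset.sum_congr rfl h2, Finset.sum_comm]
  refine Finset.sum_congr rfl fun b _ => ?_
  rw [← Finset.sum_smul, bind_apply, tsum_eq_sum (s := hp.toFinset),
    ENNReal.toReal_sum fun a _ => ENNReal.mul_ne_top (apply_ne_top _ _) (apply_ne_top _ _)]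
  · simp only [ENNReal.toReal_mul]
  · intro a ha
    have : p a = 0 := by simpa using ha
    simp [this]

theorem ev_map {p : PMF α} (f : α → β) (hp : p.support.Finite) (g : β → E) :
    (p.map f).ev g = p.ev (g ∘ f) := by
  rw [← bind_pure_comp, ev_bind hp (fun a _ => by simp)]
  simp [ev_pure, Function.comp_def]

theorem ev_uniformOfFintype [Fintype α] [Nonempty α] (g : α → E) :
    (uniformOfFintype α).ev g = (Fintype.card α : ℝ)⁻¹ • ∑ x, g x := by
  rw [ev_eq_sum (s := Finset.univ) (by simp), Finset.smul_sum]
  simp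

theorem integral_eq_ev [MeasurableSpace α] [MeasurableSingletonClass α] [CompleteSpace E]
    {p : PMF α} (hp : p.support.Finite) (g : α → E) :
    Integrable g p.toMeasure ∧ ∫ x, g x ∂p.toMeasure = p.ev g := by
  have : Integrable g p.toMeasure := by
    rw [← p.restrict_toMeasure_support]
    exact IntegrableOn.of_finite hp
  exact ⟨this, integral_eq_tsum p g this⟩

variable {p : PMF α}

theorem ev_add (hp : p.support.Finite) (f g : α → E) :
    (p.ev fun x => f x + g x) = p.ev f + p.ev g := by
  simp only [ev_eq_sum (s := hp.toFinset) (p := p) (by simp), smul_add, Finset.sum_add_distrib]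

theorem ev_sub (hp : p.support.Finite) (f g : α → E) :
    (p.ev fun x => f x - g x) = p.ev f - p.ev g := by
  simp only [ev_eq_sum (s := hp.toFinset) (p := p) (by simp), smul_sub, Finset.sum_sub_distrib]

theorem ev_const_mul {𝕜 : Type*} [NormedField 𝕜] [NormedAlgebra ℝ 𝕜] (hp : p.support.Finite)
    (c : 𝕜) (f : α → 𝕜) :
    (p.ev fun x => c * f x) = c * p.ev f := by
  simp only [ev_eq_sum (s := hp.toFinset) (p := p) (by simp), Finset.mul_sum, mul_smul_comm]

theorem ev_mono (hp : p.support.Finite) {f g : α → ℝ} (h : ∀ x ∈ p.support, f x ≤ g x) :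
    p.ev f ≤ p.ev g := by
  simp only [ev_eq_sum (s := hp.toFinset) (p := p) (by simp)]
  refine Finset.sum_le_sum fun x hx => ?_
  exact mul_le_mul_of_nonneg_left (h x (by simpa using hx)) ENNReal.toReal_nonneg

theorem norm_ev_le (hp : p.support.Finite) (f : α → E) : ‖p.ev f‖ ≤ p.ev fun x => ‖f x‖ := by
  simp only [ev_eq_sum (s := hp.toFinset) (p := p) (by simp)]
  refine (norm_sum_le _ _).trans_eq (Finset.sum_congr rfl fun x _ => ?_)
  rw [norm_smul, Real.norm_of_nonneg ENNReal.toReal_nonneg, smul_eq_mul]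

theorem ev_const (hp : p.support.Finite) (c : E) : (p.ev fun _ => c) = c := by
  have h : ∑ x ∈ hp.toFinset, p x = 1 := by
    rw [← p.tsum_coe]
    refine (tsum_eq_sum fun b hb => ?_).symm
    simpa using hb
  rw [ev_eq_sum (s := hp.toFinset) (by simp), ← Finset.sum_smul,
    ← ENNReal.toReal_sum fun a _ => apply_ne_top _ _, h]
  simp

theorem hasSum_ev (hp : p.support.Finite) {ι : Type*} {f : ι → α → E} {g : α → E}
    (h : ∀ x ∈ p.support, HasSum (fun i => f i x) (g x)) :
    HasSum (fun i => p.ev (f i)) (p.ev g) := by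
  simp only [ev_eq_sum (s := hp.toFinset) (p := p) (by simp)]
  exact hasSum_sum fun x hx => (h x (by simpa using hx)).const_smul _

end PMF

namespace BinarySaturation

/-! ### Additive weights along the random walk -/

theorem walk_succ_of_nonempty {n : ℕ} (G : Network n) (k : ℕ) {x : ℕ} (hx : x ≠ sink)
    (h : (outEdges G x).Nonempty) :
    walk G (k + 1) x = (PMF.uniformOfFinset (outEdges G x) h).bind fun e =>
      (walk G k (G e).2).map (List.cons e) := by
  rw [walk, dif_pos ⟨hx, h⟩]

theorem walk_sink {n : ℕ} (G : Network n) (k : ℕ) : walk G k sink = PMF.pure [] := by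
  cases k <;> simp [walk]

theorem finite_support_walk {n : ℕ} (G : Network n) (k x : ℕ) : (walk G k x).support.Finite := by
  induction k generalizing x with
  | zero => simp [walk]
  | succ k ih =>
    rw [walk]
    split_ifs
    · exact PMF.finite_support_bind (Set.toFinite _) fun a _ => PMF.finite_support_map _ (ih _)
    · simp

theorem fst_of_mem_outEdges {n : ℕ} {G : Network n} {x : ℕ} {e : Fin n} (h : e ∈ outEdges G x) :
    (G e).1 = x := by
  simpa [outEdges] using h

/-- Each step lowers the rank, so after `r x` steps the walk has already stopped. -/
theorem Ranked.walk_stable {n : ℕ} {G : Network n} {r : ℕ → ℕ} (h : Ranked G r) :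
    ∀ k x, r x ≤ k → walk G (k + 1) x = walk G k x := by
  intro k
  induction k with
  | zero =>
    intro x hx
    simp only [walk]
    rw [dif_neg]
    rintro ⟨-, ho⟩
    obtain ⟨e, he⟩ := outEdges_nonempty.1 ho
    have := h.lt e
    rw [he] at this
    omega
  | succ k ih =>
    intro x hx
    rw [walk, walk]
    split_ifs with hc
    · refine PMF.bind_congr_of_support fun e he => ?_
      have he' := fst_of_mem_outEdges ((PMF.mem_support_uniformOfFinset_iff _ _).1 he)
      have := h.lt e
      rw [he'] at this
      rw [ih _ (by omega)]
    · rfl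

variable {β : Type*} [AddCommMonoid β]

/-- The law of the sum of the weights `f e` along the random walk. -/
noncomputable def walkSum {n : ℕ} (G : Network n) (f : Fin n → β) (k x : ℕ) : PMF β :=
  (walk G k x).map fun p => (p.map f).sum

theorem walkSum_sink {n : ℕ} (G : Network n) (f : Fin n → β) (k : ℕ) :
    walkSum G f k sink = PMF.pure 0 := by
  simp [walkSum, walk_sink, PMF.pure_map]

theorem walkSum_succ {n : ℕ} (G : Network n) (f : Fin n → β) (k : ℕ) {x : ℕ} (hx : x ≠ sink)
    (h : (outEdges G x).Nonempty) :
    walkSum G f (k + 1) x = (PMF.uniformOfFinset (outEdges G x) h).bind fun e =>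
      (walkSum G f k (G e).2).map (f e + ·) := by
  simp only [walkSum, walk_succ_of_nonempty G k hx h, PMF.map_bind, PMF.map_comp]
  congr 1

/-- The step equation of the total weight determines its law in a ranked network. -/
theorem Ranked.walkSum_unique {n : ℕ} {G : Network n} {r : ℕ → ℕ} (hr : Ranked G r)
    (f : Fin n → β) (Q : ℕ → PMF β) (hs : Q sink = PMF.pure 0)
    (hQ : ∀ x (_ : x ≠ sink) (h : (outEdges G x).Nonempty),
      Q x = (PMF.uniformOfFinset (outEdges G x) h).bind fun e => (Q (G e).2).map (f e + ·)) :
    ∀ k x, r x ≤ k → (x ≠ sink → (outEdges G x).Nonempty) → walkSum G f k x = Q x := by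
  intro k
  induction k with
  | zero =>
    intro x hx ho
    by_cases hxs : x = sink
    · rw [hxs, walkSum_sink, hs]
    · obtain ⟨e, he⟩ := outEdges_nonempty.1 (ho hxs)
      have := hr.lt e
      rw [he] at this
      omega
  | succ k ih =>
    intro x hx ho
    by_cases hxs : x = sink
    · rw [hxs, walkSum_sink, hs]
    · rw [walkSum_succ G f k hxs (ho hxs), hQ x hxs (ho hxs)]
      refine PMF.bind_congr_of_support fun e he => ?_
      have he' := fst_of_mem_outEdges ((PMF.mem_support_uniformOfFinset_iff _ _).1 he)
      have := hr.lt e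
      rw [he'] at this
      rw [ih _ (by omega) (hr.out e)]

/-- By stability the step equation holds with the same number of steps on both sides, which is the
form needed to compare networks of different sizes. -/
theorem Ranked.walkSum_eq {n : ℕ} {G : Network n} {r : ℕ → ℕ} (hr : Ranked G r)
    (f : Fin n → β) {x : ℕ} (hx : x ≠ sink) (h : (outEdges G x).Nonempty) :
    walkSum G f n x = (PMF.uniformOfFinset (outEdges G x) h).bind fun e =>
      (walkSum G f n (G e).2).map (f e + ·) := by
  rw [← walkSum_succ, walkSum, walkSum, hr.walk_stable n x (hr.bound x)]
  exact hx

/-! ### Edge types under a growth step -/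

/-- The type of an edge: `(1, 0)` if it is the only edge leaving its first node, `(0, 1)`
otherwise. -/
def edgeType {n : ℕ} (G : Network n) (e : Fin n) : ℕ × ℕ :=
  if (outEdges G (G e).1).card = 1 then (1, 0) else (0, 1)

/-- The contribution of the edge `e` to the type counts after the doubling of the edge `j`. -/
def edgeTypeAfter {n : ℕ} (G : Network n) (j : Fin n) : Fin n → ℕ × ℕ :=
  Function.update (edgeType G) j (if (outEdges G (G j).1).card = 1 then (0, 1) else (1, 1))

theorem mem_outEdges {n : ℕ} {G : Network n} {x : ℕ} {e : Fin n} :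
    e ∈ outEdges G x ↔ (G e).1 = x := by
  simp [outEdges]

theorem outEdges_parallelDouble_of_ne {n : ℕ} (G : Network n) (j : Fin n) {x : ℕ}
    (hx : x ≠ (G j).1) :
    outEdges (parallelDouble G j) x = (outEdges G x).map Fin.castSuccEmb := by
  ext e
  induction e using Fin.lastCases with
  | last => simp [mem_outEdges, parallelDouble, hx.symm, Fin.castSucc_ne_last]
  | cast e => simp [mem_outEdges, parallelDouble]

theorem outEdges_parallelDouble_self {n : ℕ} (G : Network n) (j : Fin n)
    (hj : (outEdges G (G j).1).card = 1) :
    outEdges G (G j).1 = {j} ∧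
      outEdges (parallelDouble G j) (G j).1 = {j.castSucc, Fin.last n} := by
  have h1 : outEdges G (G j).1 = {j} := by
    obtain ⟨a, ha⟩ := Finset.card_eq_one.1 hj
    have : j ∈ outEdges G (G j).1 := mem_outEdges.2 rfl
    rw [ha] at this ⊢
    rw [Finset.mem_singleton.1 this]
  refine ⟨h1, ?_⟩
  ext e
  induction e using Fin.lastCases with
  | last => simp [mem_outEdges, parallelDouble]
  | cast e =>
    have := Finset.ext_iff.1 h1 e
    simp only [mem_outEdges, Finset.mem_singleton] at this
    simp [mem_outEdges, parallelDouble, this, Fin.castSucc_ne_last]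

theorem outEdges_serialDouble_of_ne {n : ℕ} (G : Network n) (j : Fin n) {x : ℕ}
    (hx : x ≠ n + 1) :
    outEdges (serialDouble G j) x = (outEdges G x).map Fin.castSuccEmb := by
  ext e
  induction e using Fin.lastCases with
  | last => simp [mem_outEdges, serialDouble, hx.symm, Fin.castSucc_ne_last,
      -Fin.snoc_update]
  | cast e =>
    by_cases he : e = j
    · subst he; simp [mem_outEdges, serialDouble]
    · simp [mem_outEdges, serialDouble, he]

theorem outEdges_serialDouble_new {n : ℕ} (G : Network n) (j : Fin n)
    (hG : ∀ e, (G e).1 ≤ n) :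
    outEdges (serialDouble G j) (n + 1) = {Fin.last n} := by
  have hne : ∀ e, (G e).1 ≠ n + 1 := fun e => by have := hG e; omega
  ext e
  induction e using Fin.lastCases with
  | last => simp [mem_outEdges, serialDouble, -Fin.snoc_update]
  | cast e =>
    by_cases he : e = j
    · subst he; simp [mem_outEdges, serialDouble, hne, Fin.castSucc_ne_last]
    · simp [mem_outEdges, serialDouble, he, hne, Fin.castSucc_ne_last]

theorem uniformOfFinset_map_bind {γ : Type*} {n : ℕ} {s : Finset (Fin n)}
    {t : Finset (Fin (n + 1))} (ht : t.Nonempty) (hs : s.Nonempty)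
    (hst : t = s.map Fin.castSuccEmb) {F : Fin n → PMF γ} {F' : Fin (n + 1) → PMF γ}
    (h : ∀ e ∈ s, F' e.castSucc = F e) :
    (PMF.uniformOfFinset s hs).bind F = (PMF.uniformOfFinset t ht).bind F' := by
  subst hst
  ext b
  rw [PMF.uniformOfFinset_bind_apply, PMF.uniformOfFinset_bind_apply, Finset.card_map,
    Finset.sum_map]
  congr 1
  refine Finset.sum_congr rfl fun e he => ?_
  simp [h e he]

theorem edgeTypeAfter_self {n : ℕ} (G : Network n) (j : Fin n) :
    edgeTypeAfter G j j = if (outEdges G (G j).1).card = 1 then (0, 1) else (1, 1) := by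
  simp [edgeTypeAfter]

theorem edgeTypeAfter_of_ne {n : ℕ} (G : Network n) {j e : Fin n} (h : e ≠ j) :
    edgeTypeAfter G j e = edgeType G e := by
  simp [edgeTypeAfter, h]

/-- The old law solves the step equation of the new network: at the first node of `j` the two
parallel edges lead to the same node with the same weight, so their average is the old single term.
-/
theorem Ranked.walkSum_parallelDouble {n : ℕ} {G : Network n} {r r' : ℕ → ℕ} (hr : Ranked G r)
    {j : Fin n} (hj : (outEdges G (G j).1).card = 1) (hr' : Ranked (parallelDouble G j) r') :
    walkSum (parallelDouble G j) (edgeType (parallelDouble G j)) (n + 1) source =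
      walkSum G (edgeTypeAfter G j) n source := by
  obtain ⟨h1, h2⟩ := outEdges_parallelDouble_self G j hj
  refine hr'.walkSum_unique _ (fun x => walkSum G (edgeTypeAfter G j) n x) (walkSum_sink _ _ _)
    ?_ _ _ (hr'.bound _) (fun _ => hr'.out_source)
  intro x hx ho
  have hn : (j.castSucc : Fin (n + 1)) ≠ Fin.last n := Fin.castSucc_ne_last j
  by_cases hxj : x = (G j).1
  · subst hxj
    have ho' : (outEdges G (G j).1).Nonempty := ⟨j, mem_outEdges.2 rfl⟩
    have t1 : edgeType (parallelDouble G j) j.castSucc = (0, 1) := by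
      rw [edgeType, if_neg]
      simp only [parallelDouble, Fin.snoc_castSucc] at h2 ⊢
      rw [h2, Finset.card_pair hn]; decide
    have t2 : edgeType (parallelDouble G j) (Fin.last n) = (0, 1) := by
      rw [edgeType, if_neg]
      simp only [parallelDouble, Fin.snoc_last] at h2 ⊢
      rw [h2, Finset.card_pair hn]; decide
    rw [hr.walkSum_eq _ hx ho']
    ext b
    rw [PMF.uniformOfFinset_bind_apply, PMF.uniformOfFinset_bind_apply, h1, h2,
      Finset.card_pair hn, Finset.sum_pair hn, t1, t2, edgeTypeAfter, Finset.sum_singleton,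
      Function.update_self, if_pos hj, Finset.card_singleton]
    simp only [parallelDouble, Fin.snoc_castSucc, Fin.snoc_last]
    simp only [Nat.cast_ofNat, Nat.cast_one]
    rw [← two_mul, ← mul_assoc, ENNReal.inv_mul_cancel two_ne_zero ENNReal.ofNat_ne_top]
    simp
  · have h3 := outEdges_parallelDouble_of_ne G j hxj
    have ho' : (outEdges G x).Nonempty := by rwa [h3, Finset.map_nonempty] at ho
    rw [hr.walkSum_eq _ hx ho']
    refine uniformOfFinset_map_bind _ _ h3 fun e he => ?_
    have he' := fst_of_mem_outEdges he
    have hej : e ≠ j := by rintro rfl; exact hxj he'.symm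
    rw [edgeTypeAfter_of_ne _ hej]
    simp [parallelDouble, edgeType, he'] at h3 ⊢
    simp [h3]

/-- The out-degree of the first node of `j` does not change, so only a detour through the new node
is inserted; its two weights `(0, 1)` and `(1, 0)` add up to the weight of `j` in `edgeTypeAfter`.
-/
theorem Ranked.walkSum_serialDouble {n : ℕ} {G : Network n} {r r' : ℕ → ℕ} (hr : Ranked G r)
    {j : Fin n} (hj : (outEdges G (G j).1).card ≠ 1) (hr' : Ranked (serialDouble G j) r') :
    walkSum (serialDouble G j) (edgeType (serialDouble G j)) (n + 1) source =
      walkSum G (edgeTypeAfter G j) n source := by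
  have hn := j.pos
  have hne1 : ∀ e, (G e).1 ≠ n + 1 := fun e => by have := hr.fst_le e; omega
  have hne2 : ∀ e, (G e).2 ≠ n + 1 := fun e => by have := hr.snd_le e; omega
  have hnew := outEdges_serialDouble_new G j hr.fst_le
  -- At the new node the candidate law is forced: one edge of type `(1, 0)`, then the old walk from
  -- the end of `j`.
  have hQ := hr'.walkSum_unique (edgeType (serialDouble G j))
    (fun x => if x = n + 1 then (walkSum G (edgeTypeAfter G j) n (G j).2).map ((1, 0) + ·) else
      walkSum G (edgeTypeAfter G j) n x) ?_ ?_ (n + 1) source (hr'.bound _)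
      (fun _ => hr'.out_source)
  · rw [hQ, if_neg (by simp [source])]
  · rw [if_neg (by simp [sink]; omega), walkSum_sink]
  intro x hx ho
  by_cases hxn : x = n + 1
  · subst hxn
    have t : edgeType (serialDouble G j) (Fin.last n) = (1, 0) := by
      rw [edgeType, if_pos]
      simp only [serialDouble, Fin.snoc_last] at hnew ⊢
      rw [hnew, Finset.card_singleton]
    ext b
    rw [if_pos rfl, PMF.uniformOfFinset_bind_apply, hnew, Finset.sum_singleton, t]
    simp [serialDouble, hne2]
  · have h3 := outEdges_serialDouble_of_ne G j hxn
    have ho' : (outEdges G x).Nonempty := by rwa [h3, Finset.map_nonempty] at ho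
    rw [if_neg hxn, hr.walkSum_eq _ hx ho']
    refine uniformOfFinset_map_bind _ _ h3 fun e he => ?_
    have he' := fst_of_mem_outEdges he
    by_cases hej : e = j
    · subst hej
      have t : edgeType (serialDouble G e) e.castSucc = (0, 1) := by
        rw [edgeType, if_neg]
        have hs : (serialDouble G e e.castSucc).1 = x := by simp [serialDouble, he']
        rw [hs, h3, Finset.card_map, ← he']
        exact hj
      rw [t, edgeTypeAfter_self, if_neg hj]
      simp only [serialDouble, Fin.snoc_castSucc, Function.update_self, if_true, PMF.map_comp]
      congr 1
      ext b <;> simp [add_comm, add_left_comm]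
    · rw [edgeTypeAfter_of_ne _ hej]
      simp [serialDouble, edgeType, he', hej, hne2] at h3 ⊢
      simp [h3]

/-- The type counts of a random path after a growth step. -/
theorem Ranked.walkSum_grow {n : ℕ} {G : Network n} {r : ℕ → ℕ} (hr : Ranked G r) (j : Fin n) :
    walkSum (BinarySaturation.grow G j) (edgeType (BinarySaturation.grow G j)) (n + 1) source =
      walkSum G (edgeTypeAfter G j) n source := by
  obtain ⟨r', hr'⟩ := hr.grow j
  unfold BinarySaturation.grow at hr' ⊢
  split_ifs at hr' ⊢ with h
  · exact hr.walkSum_parallelDouble h hr'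
  · exact hr.walkSum_serialDouble h hr'

/-! ### The type counts of a random path as an urn -/

theorem Ranked.nodup_of_isPath {n : ℕ} {G : Network n} {r : ℕ → ℕ} (hr : Ranked G r) {y : ℕ}
    {p : List (Fin n)} : ∀ {x : ℕ}, IsPath G x p y → p.Nodup ∧ ∀ e ∈ p, r (G e).1 ≤ r x := by
  induction p with
  | nil => simp
  | cons e p ih =>
    rintro x ⟨rfl, hp⟩
    obtain ⟨h1, h2⟩ := ih hp
    have := hr.lt e
    refine ⟨List.nodup_cons.2 ⟨fun he => ?_, h1⟩, ?_⟩
    · have := h2 e he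
      omega
    · intro e' he'
      rcases List.mem_cons.1 he' with rfl | he'
      · exact le_rfl
      · have := h2 e' he'
        omega

/-- The numbers of edges of the two types on a random path. -/
noncomputable def urnLaw (n : ℕ) : PMF (ℕ × ℕ) :=
  (networkLaw n).bind fun G => walkSum G (edgeType G) n source

theorem finite_support_networkLaw (n : ℕ) : (networkLaw n).support.Finite := by
  induction n with
  | zero => simp [networkLaw]
  | succ n ih =>
    cases n with
    | zero => simp [networkLaw]
    | succ n =>
      exact PMF.finite_support_bind ih fun G _ => PMF.finite_support_map _ (Set.toFinite _)

theorem finite_support_walkSum {n : ℕ} (G : Network n) (f : Fin n → β) (k x : ℕ) :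
    (walkSum G f k x).support.Finite :=
  PMF.finite_support_map _ (finite_support_walk G k x)

theorem finite_support_urnLaw (n : ℕ) : (urnLaw n).support.Finite :=
  PMF.finite_support_bind (finite_support_networkLaw n) fun G _ => finite_support_walkSum G _ _ _

theorem sum_edgeType {n : ℕ} (G : Network n) (p : List (Fin n)) :
    (p.map (edgeType G)).sum.1 + (p.map (edgeType G)).sum.2 = p.length := by
  induction p with
  | nil => simp
  | cons e p ih =>
    simp only [List.map_cons, List.sum_cons, Prod.fst_add, Prod.snd_add, List.length_cons, ← ih]
    unfold edgeType
    split_ifs <;> simp <;> omega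

theorem pathLengthLaw_eq (n : ℕ) : pathLengthLaw n = (urnLaw n).map fun x => x.1 + x.2 := by
  simp only [pathLengthLaw, urnLaw, PMF.map_bind, walkSum, PMF.map_comp, randomPath]
  congr 1
  ext G : 1
  congr 1
  ext p
  simp [sum_edgeType]

theorem sum_map_update {ι : Type*} [DecidableEq ι] (f : ι → β) (j : ι) (v : β) {p : List ι}
    (hp : p.Nodup) :
    (j ∉ p → (p.map (Function.update f j v)).sum = (p.map f).sum) ∧
      (j ∈ p → (p.map (Function.update f j v)).sum + f j = (p.map f).sum + v) := by
  induction p with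
  | nil => simp
  | cons e p ih =>
    obtain ⟨h1, h2⟩ := List.nodup_cons.1 hp
    obtain ⟨i1, i2⟩ := ih h2
    constructor
    · intro hj
      rw [List.mem_cons, not_or] at hj
      simp [i1 hj.2, Function.update_of_ne (Ne.symm hj.1)]
    · intro hj
      by_cases hje : j = e
      · subst hje
        simp only [List.map_cons, List.sum_cons, Function.update_self, i1 h1]
        exact (add_right_comm _ _ _).trans (by rw [add_comm v, add_right_comm])
      · have hjp : j ∈ p := (List.mem_cons.1 hj).resolve_left hje
        simp only [List.map_cons, List.sum_cons, Function.update_of_ne (Ne.symm hje)]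
        rw [add_assoc, i2 hjp, add_assoc]

variable {E : Type*} [NormedAddCommGroup E] [NormedSpace ℝ E]

/-- The generator of the branching process that describes the type counts. -/
noncomputable def generator (g : ℕ × ℕ → E) (x : ℕ × ℕ) : E :=
  (x.1 : ℝ) • (g (x.1 - 1, x.2 + 1) - g x) + (x.2 : ℝ) • (g (x.1 + 1, x.2) - g x)

/-- A path without repetitions meets each edge once, so exactly x.1 choices of `j` hit the first
type, x.2 hit the second, and all others leave the counts unchanged. -/
theorem sum_edgeTypeAfter {n : ℕ} (G : Network n) {p : List (Fin n)} (hp : p.Nodup)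
    (g : ℕ × ℕ → E) :
    ∑ j, g (p.map (edgeTypeAfter G j)).sum =
      (n : ℝ) • g (p.map (edgeType G)).sum + generator g (p.map (edgeType G)).sum := by
  set x := (p.map (edgeType G)).sum with hx
  have key : ∀ j, g (p.map (edgeTypeAfter G j)).sum - g x =
      if j ∈ p.toFinset then ((edgeType G j).1 : ℝ) • (g (x.1 - 1, x.2 + 1) - g x)
        + ((edgeType G j).2 : ℝ) • (g (x.1 + 1, x.2) - g x) else 0 := by
    intro j
    obtain ⟨h1, h2⟩ := sum_map_update (edgeType G) j
      (if (outEdges G (G j).1).card = 1 then (0, 1) else (1, 1)) hp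
    split_ifs with hj
    · have h3 := h2 (List.mem_toFinset.1 hj)
      rw [← hx] at h3
      change (p.map (edgeTypeAfter G j)).sum + _ = _ at h3
      obtain ⟨a, b⟩ := x
      generalize (p.map (edgeTypeAfter G j)).sum = y at h3 ⊢
      obtain ⟨c, d⟩ := y
      unfold edgeType at h3 ⊢
      split_ifs at h3 ⊢ <;> simp only [Prod.mk_add_mk, Prod.mk.injEq] at h3
      · obtain ⟨rfl, rfl⟩ : c = a - 1 ∧ d = b + 1 := by omega
        simp
      · obtain ⟨rfl, rfl⟩ : c = a + 1 ∧ d = b := by omega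
        simp
    · rw [edgeTypeAfter, h1 (by simpa using hj), hx, sub_self]
  have hs : ∑ j, (g (p.map (edgeTypeAfter G j)).sum - g x) = generator g x := by
    rw [Finset.sum_congr rfl fun j _ => key j, Finset.sum_ite_mem, Finset.univ_inter,
      Finset.sum_add_distrib, ← Finset.sum_smul, ← Finset.sum_smul, generator]
    have : x = ∑ j ∈ p.toFinset, edgeType G j := by rw [hx, List.sum_toFinset _ hp]
    have e1 : ∑ j ∈ p.toFinset, ((edgeType G j).1 : ℝ) = x.1 := by
      rw [this, Prod.fst_sum]; push_cast; rfl
    have e2 : ∑ j ∈ p.toFinset, ((edgeType G j).2 : ℝ) = x.2 := by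
      rw [this, Prod.snd_sum]; push_cast; rfl
    rw [e1, e2]
  rw [← hs, Finset.sum_sub_distrib, Finset.sum_const, Finset.card_univ, Fintype.card_fin,
    Nat.cast_smul_eq_nsmul]
  abel

theorem ev_urnLaw_one (g : ℕ × ℕ → E) : (urnLaw 1).ev g = g (1, 0) := by
  have hs : ∀ x, outEdges (fun _ : Fin 1 => (source, sink)) x =
      if x = source then {0} else ∅ := by
    intro x
    ext e
    split_ifs with h
    · simp [mem_outEdges, h, Subsingleton.elim e 0]
    · simp [mem_outEdges, Ne.symm h]
  have h0 : (outEdges (fun _ : Fin 1 => (source, sink)) source).Nonempty := by simp [hs]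
  have : urnLaw 1 = PMF.pure (1, 0) := by
    rw [urnLaw, networkLaw, PMF.pure_bind,
      walkSum_succ _ _ _ (by simp [source, sink]) h0]
    ext b
    rw [PMF.uniformOfFinset_bind_apply, hs, if_pos rfl]
    simp [walkSum_sink, PMF.pure_map, edgeType, hs]
  rw [this, PMF.ev_pure]

/-- After the growth step is moved into the weights, the walk takes place in the old network,
independently of `j`; the path can therefore be drawn before the edge. -/
theorem urnLaw_succ (n : ℕ) : urnLaw (n + 2) = (networkLaw (n + 1)).bind fun G =>
    (walk G (n + 1) source).bind fun p =>
      (PMF.uniformOfFintype (Fin (n + 1))).map fun j => (p.map (edgeTypeAfter G j)).sum := by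
  rw [urnLaw, networkLaw, PMF.bind_bind]
  refine PMF.bind_congr_of_support fun G hG => ?_
  obtain ⟨r, hr⟩ := exists_ranked n G hG
  rw [PMF.bind_map]
  trans (PMF.uniformOfFintype (Fin (n + 1))).bind fun j =>
    walkSum G (edgeTypeAfter G j) (n + 1) source
  · congr 1
    ext j : 1
    exact hr.walkSum_grow j
  simp only [walkSum, ← PMF.bind_pure_comp, Function.comp_def]
  exact PMF.bind_comm _ _ _

theorem ev_urnLaw_succ (n : ℕ) (g : ℕ × ℕ → E) : (urnLaw (n + 2)).ev g =
    (urnLaw (n + 1)).ev fun x => g x + ((n : ℝ) + 1)⁻¹ • generator g x := by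
  rw [urnLaw_succ, urnLaw, PMF.ev_bind (finite_support_networkLaw _) fun G _ =>
      PMF.finite_support_bind (finite_support_walk _ _ _) fun p _ =>
        PMF.finite_support_map _ (Set.toFinite _),
    PMF.ev_bind (finite_support_networkLaw _) fun G _ => finite_support_walkSum _ _ _ _]
  refine PMF.ev_congr fun G hG => ?_
  obtain ⟨r, hr⟩ := exists_ranked n G hG
  rw [PMF.ev_bind (finite_support_walk _ _ _) fun p _ =>
    PMF.finite_support_map _ (Set.toFinite _), walkSum, PMF.ev_map _ (finite_support_walk _ _ _)]
  refine PMF.ev_congr fun p hp => ?_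
  have hnd := (hr.nodup_of_isPath
    (hr.walk_isPath _ _ (hr.bound _) (fun _ => hr.out_source) p hp)).1
  rw [PMF.ev_map _ (Set.toFinite _), PMF.ev_uniformOfFintype]
  simp only [Function.comp_def]
  rw [sum_edgeTypeAfter G hnd, smul_add, smul_smul, Fintype.card_fin, Nat.cast_succ,
    inv_mul_cancel₀ (by positivity), one_smul]

/-! ### The exponent and the coefficients of the limit law -/

theorem phi_sq : phi ^ 2 = 1 - phi := by
  have : (√5 : ℝ) ^ 2 = 5 := Real.sq_sqrt (by norm_num)
  unfold phi
  linear_combination this / 4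

theorem half_lt_phi : 1 / 2 < phi := by
  have : (2 : ℝ) < √5 := Real.lt_sqrt_of_sq_lt (by norm_num)
  unfold phi
  linarith

theorem phi_pos : 0 < phi := by linarith [half_lt_phi]

theorem phi_lt_one : phi < 1 := by nlinarith [phi_sq, phi_pos]

/-- The numbers `c_r`, up to the factor `r! / Γ (r φ + 1)` the moments of the limit law. -/
noncomputable def limitCoeff : ℕ → ℝ
  | 0 => 1
  | 1 => (3 + phi) / 5
  | r + 2 => 1 / (((r : ℝ) + 1) * phi * (((r : ℝ) + 3) * phi + 1)) *
      ∑ k : Fin (r + 1), (((k : ℕ) + 1 : ℝ) * phi + 1) * limitCoeff (k + 1) * limitCoeff (r + 1 - k)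
  decreasing_by all_goals omega

theorem limitCoeff_zero : limitCoeff 0 = 1 := by rw [limitCoeff]

theorem limitCoeff_one : limitCoeff 1 = (3 + phi) / 5 := by rw [limitCoeff]

theorem limitCoeff_add_two (r : ℕ) : limitCoeff (r + 2) =
    1 / (((r : ℝ) + 1) * phi * (((r : ℝ) + 3) * phi + 1)) *
      ∑ k ∈ Finset.range (r + 1),
        (((k : ℕ) + 1 : ℝ) * phi + 1) * limitCoeff (k + 1) * limitCoeff (r + 1 - k) := by
  rw [limitCoeff, Finset.sum_range]

theorem limitCoeff_rec (r : ℕ) (hr : 2 ≤ r) : limitCoeff r =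
    1 / (((r : ℝ) - 1) * phi * (((r : ℝ) + 1) * phi + 1)) *
      ∑ k ∈ Finset.Icc 1 (r - 1), ((k : ℝ) * phi + 1) * limitCoeff k * limitCoeff (r - k) := by
  obtain ⟨m, rfl⟩ : ∃ m, r = m + 2 := ⟨r - 2, by omega⟩
  have h : Finset.Icc 1 (m + 2 - 1) = Finset.Ico 1 (m + 2) := by ext; simp; omega
  rw [limitCoeff_add_two, h, Finset.sum_Ico_eq_sum_range]
  congr 1
  · push_cast; ring_nf
  · refine Finset.sum_congr rfl fun k hk => ?_
    rw [show m + 2 - (1 + k) = m + 1 - k by omega, add_comm 1 k]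
    push_cast
    rfl

theorem limitCoeff_nonneg (r : ℕ) : 0 ≤ limitCoeff r := by
  have := phi_pos
  induction r using Nat.strong_induction_on with
  | _ r ih =>
    match r with
    | 0 => simp [limitCoeff_zero]
    | 1 => rw [limitCoeff_one]; positivity
    | r + 2 =>
      rw [limitCoeff_add_two]
      refine mul_nonneg (by positivity) (Finset.sum_nonneg fun k hk => ?_)
      have := Finset.mem_range.1 hk
      exact mul_nonneg (mul_nonneg (by positivity) (ih _ (by omega))) (ih _ (by omega))

/-- Under the induction hypothesis each of the r + 1 summands is at most ((r + 3) φ + 1) φ^(-r), and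
the prefactor cancels everything except one factor 1 / φ. The resulting geometric growth makes C and
D converge for |s| < φ. -/
theorem limitCoeff_succ_le (r : ℕ) : limitCoeff (r + 1) ≤ (phi⁻¹) ^ r := by
  have h0 := phi_pos
  have h1 := phi_lt_one
  induction r using Nat.strong_induction_on with
  | _ r ih =>
    match r with
    | 0 => rw [limitCoeff_one]; linarith [pow_zero (phi⁻¹)]
    | r + 1 =>
      have hb : ∑ k ∈ Finset.range (r + 1),
          (((k : ℕ) + 1 : ℝ) * phi + 1) * limitCoeff (k + 1) * limitCoeff (r + 1 - k) ≤
          ∑ k ∈ Finset.range (r + 1), (((r : ℝ) + 3) * phi + 1) * (phi⁻¹) ^ r := by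
        refine Finset.sum_le_sum fun k hk => ?_
        have hk' : k ≤ r := by have := Finset.mem_range.1 hk; omega
        have e1 := ih k (by omega)
        have e2 := ih (r - k) (by omega)
        rw [show r - k + 1 = r + 1 - k by omega] at e2
        have e3 : (phi⁻¹) ^ r = (phi⁻¹) ^ k * (phi⁻¹) ^ (r - k) := by
          rw [← pow_add]; congr 1; omega
        have hkr : (k : ℝ) ≤ r := by exact_mod_cast hk'
        rw [e3, ← mul_assoc]
        refine mul_le_mul (mul_le_mul ?_ e1 (limitCoeff_nonneg _) (by positivity)) e2
          (limitCoeff_nonneg _) (by positivity)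
        nlinarith
      rw [limitCoeff_add_two]
      calc _ ≤ 1 / (((r : ℝ) + 1) * phi * (((r : ℝ) + 3) * phi + 1)) *
            ∑ k ∈ Finset.range (r + 1), (((r : ℝ) + 3) * phi + 1) * (phi⁻¹) ^ r :=
            mul_le_mul_of_nonneg_left hb (by positivity)
        _ = (phi⁻¹) ^ (r + 1) := by
            rw [Finset.sum_const, Finset.card_range, nsmul_eq_mul, pow_succ]
            push_cast
            field_simp

theorem limitCoeff_le (r : ℕ) : limitCoeff r ≤ (phi⁻¹) ^ r := by
  cases r with
  | zero => simp [limitCoeff_zero]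
  | succ r =>
    refine (limitCoeff_succ_le r).trans (pow_le_pow_right₀ ?_ (Nat.le_succ r))
    exact (one_le_inv₀ phi_pos).2 phi_lt_one.le

/-! ### Generating functions and eigenfunctions of the generator -/

open PowerSeries in
/-- The generating function of the `c_r`. -/
noncomputable def seriesC : PowerSeries ℝ := mk limitCoeff

open PowerSeries in
/-- The generating function of the numbers `(1 + r φ) c_r`. -/
noncomputable def seriesD : PowerSeries ℝ := mk fun r => (1 + r * phi) * limitCoeff r

open PowerSeries in
theorem coeff_X_mul_derivative (f : PowerSeries ℝ) (r : ℕ) :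
    coeff r (X * d⁄dX ℝ f) = r * coeff r f := by
  cases r with
  | zero => simp
  | succ r => rw [coeff_succ_X_mul, coeff_derivative]; push_cast; ring

open PowerSeries in
theorem seriesC_ode : phi • (X * d⁄dX ℝ seriesC) = seriesD - seriesC := by
  ext r
  rw [map_smul, coeff_X_mul_derivative, map_sub, seriesC, seriesD, coeff_mk, coeff_mk, smul_eq_mul]
  ring

/-- The recursion with its two end terms restored: (1 + r φ)² - 1 - (1 + r φ) = (r - 1) φ ((r + 1) φ
+ 1) because φ² = 1 - φ. -/
theorem sum_limitCoeff (r : ℕ) :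
    ∑ i ∈ Finset.range (r + 1), (1 + i * phi) * limitCoeff i * limitCoeff (r - i) =
      (1 + r * phi) * ((1 + r * phi) * limitCoeff r) := by
  match r with
  | 0 => simp [limitCoeff_zero]
  | 1 =>
    rw [Finset.sum_range_succ, Finset.sum_range_one]
    simp only [limitCoeff_zero, Nat.sub_self, Nat.sub_zero]
    push_cast
    -- For r = 1 the equation reduces to φ² + φ = 1 and puts no condition on c_1.
    linear_combination (-limitCoeff 1) * phi_sq
  | r + 2 =>
    have hp := phi_pos
    have h : ∑ k ∈ Finset.range (r + 1),
        (((k : ℕ) + 1 : ℝ) * phi + 1) * limitCoeff (k + 1) * limitCoeff (r + 1 - k) =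
        (((r : ℝ) + 1) * phi * (((r : ℝ) + 3) * phi + 1)) * limitCoeff (r + 2) := by
      rw [limitCoeff_add_two]
      have : (((r : ℝ) + 1) * phi * (((r : ℝ) + 3) * phi + 1)) ≠ 0 := by positivity
      rw [one_div, mul_inv_cancel_left₀ this]
    rw [Finset.sum_range_succ, Finset.sum_range_succ']
    have h' : ∑ k ∈ Finset.range (r + 1), (1 + ((k + 1 : ℕ) : ℝ) * phi) * limitCoeff (k + 1) *
        limitCoeff (r + 2 - (k + 1)) = ∑ k ∈ Finset.range (r + 1),
        (((k : ℕ) + 1 : ℝ) * phi + 1) * limitCoeff (k + 1) * limitCoeff (r + 1 - k) := by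
      refine Finset.sum_congr rfl fun k hk => ?_
      rw [show r + 2 - (k + 1) = r + 1 - k by omega]
      push_cast
      ring
    rw [h', h, Nat.sub_self, Nat.sub_zero, limitCoeff_zero]
    push_cast
    linear_combination (-limitCoeff (r + 2)) * phi_sq

open PowerSeries in
theorem seriesD_ode : phi • (X * d⁄dX ℝ seriesD) = seriesC * seriesD - seriesD := by
  ext r
  rw [map_smul, coeff_X_mul_derivative, map_sub, mul_comm seriesC, coeff_mul,
    Finset.Nat.sum_antidiagonal_eq_sum_range_succ_mk]
  simp only [seriesC, seriesD, coeff_mk, smul_eq_mul]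
  rw [sum_limitCoeff]
  ring

-- Both sides are derivations on monomials and agree on C and D by the two differential equations.
-- The truncated exponent `a - 1` is harmless at a = 0, where its factor vanishes.
open PowerSeries in
theorem seriesC_seriesD_ode (a b : ℕ) :
    (a : ℝ) • (seriesC ^ (a - 1) * seriesD ^ (b + 1) - seriesC ^ a * seriesD ^ b) +
      (b : ℝ) • (seriesC ^ (a + 1) * seriesD ^ b - seriesC ^ a * seriesD ^ b) =
      phi • (X * d⁄dX ℝ (seriesC ^ a * seriesD ^ b)) := by
  have h1 := seriesC_ode
  have h2 := seriesD_ode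
  rw [Derivation.leibniz, derivative_pow, derivative_pow]
  simp only [smul_eq_mul, smul_eq_C_mul] at h1 h2 ⊢
  have hC : ∀ n : ℕ, C (n : ℝ) = (n : PowerSeries ℝ) := fun n => map_natCast _ n
  rw [hC, hC]
  have ha : (a : PowerSeries ℝ) * seriesC ^ a = a * (seriesC ^ (a - 1) * seriesC) := by
    cases a with
    | zero => simp
    | succ a => simp [pow_succ]
  have hb : (b : PowerSeries ℝ) * seriesD ^ b = b * (seriesD ^ (b - 1) * seriesD) := by
    cases b with
    | zero => simp
    | succ b => simp [pow_succ]
  linear_combination (-(a : PowerSeries ℝ) * seriesC ^ (a - 1) * seriesD ^ b) * h1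
    - ((b : PowerSeries ℝ) * seriesD ^ (b - 1) * seriesC ^ a) * h2
    - seriesD ^ b * ha + (seriesC ^ (a + 1) - seriesC ^ a) * hb

open PowerSeries in
/-- The eigenfunction of the generator for the eigenvalue `r φ`. -/
noncomputable def eigenfunction (r : ℕ) (x : ℕ × ℕ) : ℝ :=
  coeff r (seriesC ^ x.1 * seriesD ^ x.2)

theorem generator_eigenfunction (r : ℕ) (x : ℕ × ℕ) :
    generator (eigenfunction r) x = (r * phi) * eigenfunction r x := by
  have h := congrArg (PowerSeries.coeff r) (seriesC_seriesD_ode x.1 x.2)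
  simp only [map_add, map_smul, map_sub, coeff_X_mul_derivative, smul_eq_mul] at h
  simp only [generator, eigenfunction, smul_eq_mul, h]
  ring

/-! ### Exact expectations and the generating function -/

/-- The product `(1 + x) (1 + x / 2) ⋯ (1 + x / n)`. -/
noncomputable def riseProd (x : ℝ) (n : ℕ) : ℝ := ∏ k ∈ Finset.range n, (1 + x / (k + 1))

theorem ev_urnLaw_of_generator {g : ℕ × ℕ → ℝ} {l : ℝ} (hg : ∀ x, generator g x = l * g x)
    (n : ℕ) : (urnLaw (n + 1)).ev g = riseProd l n * g (1, 0) := by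
  induction n with
  | zero => simp [ev_urnLaw_one, riseProd]
  | succ n ih =>
    rw [ev_urnLaw_succ]
    have : ∀ x, g x + ((n : ℝ) + 1)⁻¹ • generator g x = (1 + l / (n + 1)) * g x := by
      intro x; rw [hg, smul_eq_mul]; field_simp
    simp only [this]
    rw [PMF.ev_const_mul (finite_support_urnLaw _), ih, riseProd, riseProd,
      Finset.prod_range_succ]
    ring

theorem ev_eigenfunction (r n : ℕ) :
    (urnLaw (n + 1)).ev (eigenfunction r) = limitCoeff r * riseProd (r * phi) n := by
  rw [ev_urnLaw_of_generator (generator_eigenfunction r)]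
  simp [eigenfunction, seriesC, mul_comm]

/-- Absolute convergence of a real power series at a complex number, with the sum `v`. -/
def AbsEval (f : PowerSeries ℝ) (s v : ℂ) : Prop :=
  (Summable fun r => ‖((PowerSeries.coeff r f : ℝ) : ℂ) * s ^ r‖) ∧
    HasSum (fun r => ((PowerSeries.coeff r f : ℝ) : ℂ) * s ^ r) v

theorem AbsEval.mul {f g : PowerSeries ℝ} {s v w : ℂ} (hf : AbsEval f s v) (hg : AbsEval g s w) :
    AbsEval (f * g) s (v * w) := by
  have e : (fun r => ((PowerSeries.coeff r (f * g) : ℝ) : ℂ) * s ^ r) = fun r =>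
      ∑ kl ∈ Finset.HasAntidiagonal.antidiagonal r, (((PowerSeries.coeff kl.1 f : ℝ) : ℂ) * s ^ kl.1) *
        (((PowerSeries.coeff kl.2 g : ℝ) : ℂ) * s ^ kl.2) := by
    funext r
    rw [PowerSeries.coeff_mul, Complex.ofReal_sum, Finset.sum_mul]
    refine Finset.sum_congr rfl fun kl hkl => ?_
    rw [← Finset.HasAntidiagonal.mem_antidiagonal.1 hkl, pow_add]
    push_cast
    ring
  have h1 := summable_norm_sum_mul_antidiagonal_of_summable_norm hf.1 hg.1
  refine ⟨?_, ?_⟩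
  · simpa only [← funext_iff.1 e] using h1
  · rw [e, ← hf.2.tsum_eq, ← hg.2.tsum_eq,
      tsum_mul_tsum_eq_tsum_sum_antidiagonal_of_summable_norm hf.1 hg.1]
    exact h1.of_norm.hasSum

theorem AbsEval.one (s : ℂ) : AbsEval 1 s 1 := by
  have h : ∀ r ≠ 0, ((PowerSeries.coeff r (1 : PowerSeries ℝ) : ℝ) : ℂ) * s ^ r = 0 := by
    intro r hr
    simp [PowerSeries.coeff_one, hr]
  refine ⟨summable_of_ne_finset_zero (s := {0}) fun r hr => ?_, ?_⟩
  · rw [h r (by simpa using hr), norm_zero]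
  · simpa using hasSum_single (f := fun r => ((PowerSeries.coeff r (1 : PowerSeries ℝ) : ℝ) : ℂ) * s ^ r)
      0 h

theorem AbsEval.pow {f : PowerSeries ℝ} {s v : ℂ} (hf : AbsEval f s v) (n : ℕ) :
    AbsEval (f ^ n) s (v ^ n) := by
  induction n with
  | zero => simpa using AbsEval.one s
  | succ n ih => rw [pow_succ, pow_succ]; exact ih.mul hf

theorem summable_seriesD {s : ℂ} (hs : ‖s‖ < phi) :
    Summable fun r : ℕ => ‖((PowerSeries.coeff r seriesD : ℝ) : ℂ) * s ^ r‖ := by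
  have hp := phi_pos
  have hq : ‖‖s‖ / phi‖ < 1 := by
    rw [Real.norm_of_nonneg (by positivity), div_lt_one hp]; exact hs
  have h1 := summable_pow_mul_geometric_of_norm_lt_one 0 hq
  have h2 := (summable_pow_mul_geometric_of_norm_lt_one 1 hq).mul_left phi
  refine (h1.add h2).of_nonneg_of_le (fun r => norm_nonneg _) fun r => ?_
  have hc := limitCoeff_nonneg r
  rw [norm_mul, norm_pow, Complex.norm_real, seriesD, PowerSeries.coeff_mk,
    Real.norm_of_nonneg (by positivity), div_pow]
  calc _ ≤ (1 + r * phi) * (phi⁻¹) ^ r * ‖s‖ ^ r := by gcongr; exact limitCoeff_le r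
    _ = _ := by rw [inv_pow]; field_simp

theorem summable_seriesC {s : ℂ} (hs : ‖s‖ < phi) :
    Summable fun r : ℕ => ‖((PowerSeries.coeff r seriesC : ℝ) : ℂ) * s ^ r‖ := by
  refine (summable_seriesD hs).of_nonneg_of_le (fun r => norm_nonneg _) fun r => ?_
  have hp := phi_pos
  have hc := limitCoeff_nonneg r
  rw [norm_mul, norm_mul, Complex.norm_real, Complex.norm_real, seriesD, seriesC,
    PowerSeries.coeff_mk, PowerSeries.coeff_mk, Real.norm_of_nonneg hc,
    Real.norm_of_nonneg (by positivity)]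
  gcongr
  have : 0 ≤ (r : ℝ) * phi := by positivity
  nlinarith

/-- The value of a real power series at a complex number. -/
noncomputable def seriesEval (f : PowerSeries ℝ) (s : ℂ) : ℂ :=
  ∑' r, ((PowerSeries.coeff r f : ℝ) : ℂ) * s ^ r

theorem hasSum_eigenfunction {s : ℂ} (hs : ‖s‖ < phi) (x : ℕ × ℕ) :
    HasSum (fun r => (eigenfunction r x : ℂ) * s ^ r)
      (seriesEval seriesC s ^ x.1 * seriesEval seriesD s ^ x.2) := by
  have hC : AbsEval seriesC s (seriesEval seriesC s) :=
    ⟨summable_seriesC hs, (summable_seriesC hs).of_norm.hasSum⟩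
  have hD : AbsEval seriesD s (seriesEval seriesD s) :=
    ⟨summable_seriesD hs, (summable_seriesD hs).of_norm.hasSum⟩
  exact ((hC.pow x.1).mul (hD.pow x.2)).2

theorem ev_ofReal_mul {p : PMF (ℕ × ℕ)} (hp : p.support.Finite) (g : ℕ × ℕ → ℝ) (z : ℂ) :
    (p.ev fun x => (g x : ℂ) * z) = ((p.ev g : ℝ) : ℂ) * z := by
  simp only [PMF.ev_eq_sum (s := hp.toFinset) (p := p) (by simp), Complex.ofReal_sum,
    Finset.sum_mul, Complex.real_smul, smul_eq_mul, Complex.ofReal_mul, mul_assoc]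

/-- The generating function of the eigenfunctions is C(s)^a D(s)^b, and the support is finite, so
expectation and sum commute. -/
theorem hasSum_ev_urnLaw {s : ℂ} (hs : ‖s‖ < phi) (n : ℕ) :
    HasSum (fun r : ℕ => ((limitCoeff r * riseProd (r * phi) n : ℝ) : ℂ) * s ^ r)
      ((urnLaw (n + 1)).ev fun x => seriesEval seriesC s ^ x.1 * seriesEval seriesD s ^ x.2) := by
  have := PMF.hasSum_ev (finite_support_urnLaw (n + 1)) fun x _ => hasSum_eigenfunction hs x
  simpa only [ev_ofReal_mul (finite_support_urnLaw _), ev_eigenfunction] using this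

/-! ### Linear eigenfunctions and the mean length -/

theorem generator_linear (α β : ℝ) (x : ℕ × ℕ) :
    generator (fun x : ℕ × ℕ => α * x.1 + β * x.2) x = (β - α) * x.1 + α * x.2 := by
  obtain ⟨a, b⟩ := x
  -- At a = 0 the truncated `a - 1` is multiplied by zero.
  cases a with
  | zero => simp [generator]; ring
  | succ a => simp [generator]; ring

/-- The linear eigenfunction of the generator for the eigenvalue `φ`. -/
noncomputable def mainPart (x : ℕ × ℕ) : ℝ :=
  limitCoeff 1 * x.1 + limitCoeff 1 * (1 + phi) * x.2

/-- The linear eigenfunction of the generator for the negative eigenvalue `-(1 + φ)`. -/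
noncomputable def minorPart (x : ℕ × ℕ) : ℝ := 1 * x.1 + (-phi) * x.2

theorem generator_mainPart (x : ℕ × ℕ) : generator mainPart x = phi * mainPart x := by
  refine (generator_linear _ _ x).trans ?_
  unfold mainPart
  linear_combination (-limitCoeff 1 * x.2) * phi_sq

theorem generator_minorPart (x : ℕ × ℕ) :
    generator minorPart x = -(1 + phi) * minorPart x := by
  refine (generator_linear _ _ x).trans ?_
  unfold minorPart
  linear_combination (-x.2 : ℝ) * phi_sq

theorem length_eq_parts (x : ℕ × ℕ) :
    (x.1 : ℝ) + x.2 = mainPart x + (2 - phi) / 5 * minorPart x := by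
  unfold mainPart minorPart
  rw [limitCoeff_one]
  linear_combination (-2 / 5 * x.2 : ℝ) * phi_sq

theorem ev_length (n : ℕ) : ((urnLaw (n + 1)).ev fun x => (x.1 : ℝ) + x.2) =
    (3 + phi) / 5 * riseProd phi n + (2 - phi) / 5 * riseProd (-(1 + phi)) n := by
  simp only [length_eq_parts]
  rw [PMF.ev_add (finite_support_urnLaw _), PMF.ev_const_mul (finite_support_urnLaw _),
    ev_urnLaw_of_generator generator_mainPart, ev_urnLaw_of_generator generator_minorPart]
  simp [mainPart, minorPart, limitCoeff_one]
  ring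

theorem eval_ascPochhammer_succ (x : ℝ) (n : ℕ) :
    (ascPochhammer ℝ (n + 1)).eval x = x * riseProd x n * n.factorial := by
  induction n with
  | zero => simp [riseProd]
  | succ n ih =>
    rw [ascPochhammer_succ_eval, ih, riseProd, riseProd, Finset.prod_range_succ,
      Nat.factorial_succ]
    push_cast
    field_simp
    ring

/-- The binomial coefficient is the rising factorial x (x + 1) ⋯ (x + n) over (n + 1)!; pulling out
x and dividing each remaining factor x + k by k leaves the product. -/
theorem mul_choose_eq_riseProd (x : ℝ) (n : ℕ) :
    ((n + 1 : ℕ) : ℝ) * Ring.choose (((n + 1 : ℕ) : ℝ) + (x - 1)) (n + 1) = x * riseProd x n := by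
  have h := Ring.factorial_nsmul_multichoose_eq_ascPochhammer x (n + 1)
  rw [Polynomial.ascPochhammer_smeval_eq_eval, eval_ascPochhammer_succ, nsmul_eq_mul, Nat.factorial_succ,
    Nat.cast_mul] at h
  rw [Ring.choose, show ((n + 1 : ℕ) : ℝ) + (x - 1) - ((n + 1 : ℕ) : ℝ) + 1 = x by ring]
  have hn : (n.factorial : ℝ) ≠ 0 := by positivity
  refine mul_right_cancel₀ hn ?_
  linear_combination h

theorem ev_length_eq_choose (n : ℕ) (hn : 1 ≤ n) :
    ((urnLaw n).ev fun x => (x.1 : ℝ) + x.2) =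
      n * ((3 + √5) / (2 * √5) * Ring.choose ((n : ℝ) + √5 / 2 - 3 / 2) n
          - (3 - √5) / (2 * √5) * Ring.choose ((n : ℝ) - √5 / 2 - 3 / 2) n) := by
  obtain ⟨m, rfl⟩ : ∃ m, n = m + 1 := ⟨n - 1, by omega⟩
  have h5 : (√5 : ℝ) ^ 2 = 5 := Real.sq_sqrt (by norm_num)
  have h0 : (√5 : ℝ) ≠ 0 := by positivity
  have h1 := mul_choose_eq_riseProd phi m
  have h2 := mul_choose_eq_riseProd (-(1 + phi)) m
  rw [show ((m + 1 : ℕ) : ℝ) + (phi - 1) = ((m + 1 : ℕ) : ℝ) + √5 / 2 - 3 / 2 by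
    unfold phi; ring] at h1
  rw [show ((m + 1 : ℕ) : ℝ) + (-(1 + phi) - 1) = ((m + 1 : ℕ) : ℝ) - √5 / 2 - 3 / 2 by
    unfold phi; ring] at h2
  rw [ev_length, mul_sub, mul_left_comm, h1, mul_left_comm ((m + 1 : ℕ) : ℝ), h2]
  have e1 : (3 + √5) / (2 * √5) * phi = (3 + phi) / 5 := by
    unfold phi; field_simp; linear_combination 3 * h5
  have e2 : (3 - √5) / (2 * √5) * (-(1 + phi)) = -((2 - phi) / 5) := by
    unfold phi; field_simp; linear_combination 3 * h5
  rw [← mul_assoc, e1, ← mul_assoc, e2]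
  ring

/-! ### Asymptotics of the products and of the mean -/

theorem riseProd_pos {x : ℝ} (hx : 0 ≤ x) (n : ℕ) : 0 < riseProd x n :=
  Finset.prod_pos fun k _ => by positivity

theorem abs_riseProd_neg_le (n : ℕ) : |riseProd (-(1 + phi)) n| ≤ 1 := by
  rw [riseProd, Finset.abs_prod]
  refine Finset.prod_le_one (fun _ _ => abs_nonneg _) fun k _ => ?_
  have h0 := phi_pos
  have h1 := phi_lt_one
  have h2 : (1 + phi) / ((k : ℝ) + 1) ≤ 2 := by
    rw [div_le_iff₀ (by positivity)]
    nlinarith [Nat.cast_nonneg (α := ℝ) k]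
  have h3 : 0 ≤ (1 + phi) / ((k : ℝ) + 1) := by positivity
  rw [neg_div, abs_le]
  constructor <;> linarith

/-- Euler's limit for the Gamma function: `Real.GammaSeq x n` equals n^x / (x `riseProd x n`) for n,
x > 0. -/
theorem tendsto_riseProd {x : ℝ} (hx : 0 ≤ x) :
    Tendsto (fun n : ℕ => riseProd x n / ((n + 1 : ℕ) : ℝ) ^ x) atTop
      (𝓝 (1 / Real.Gamma (x + 1))) := by
  have h1 : Tendsto (fun n : ℕ => riseProd x n / (n : ℝ) ^ x) atTop
      (𝓝 (1 / Real.Gamma (x + 1))) := by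
    rcases hx.eq_or_lt with rfl | hx
    · simp [riseProd]
    · have h := ((Real.GammaSeq_tendsto_Gamma x).const_mul x).inv₀
        (mul_ne_zero hx.ne' (Real.Gamma_pos_of_pos hx).ne')
      rw [← Real.Gamma_add_one hx.ne', ← one_div] at h
      refine h.congr' ?_
      filter_upwards [eventually_gt_atTop 0] with n hn
      have hprod : ∏ j ∈ Finset.range (n + 1), (x + j) = x * riseProd x n * n.factorial := by
        rw [← eval_ascPochhammer_succ]
        clear hn
        induction n + 1 with
        | zero => simp
        | succ k ih => rw [Finset.prod_range_succ, ascPochhammer_succ_eval, ih]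
      have hn' : 0 < (n : ℝ) ^ x := Real.rpow_pos_of_pos (by exact_mod_cast hn) _
      have hr := riseProd_pos hx.le n
      rw [Real.GammaSeq, hprod]
      field_simp
  -- Size n + 1 goes with n factors: shift the limit by one and divide out the surplus factor, which
  -- tends to 1.
  have h2 := (tendsto_add_atTop_iff_nat (f := fun n : ℕ => riseProd x n / (n : ℝ) ^ x) 1).2 h1
  have h3 : Tendsto (fun n : ℕ => 1 + x * (1 / ((n : ℝ) + 1))) atTop (𝓝 (1 + x * 0)) :=
    (tendsto_one_div_add_atTop_nhds_zero_nat.const_mul x).const_add 1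
  have h4 := h2.div h3 (by simp)
  rw [mul_zero, add_zero, div_one] at h4
  refine h4.congr fun n => ?_
  have : 0 < 1 + x / ((n : ℝ) + 1) := by positivity
  simp only [Pi.div_apply]
  rw [riseProd, Finset.prod_range_succ, ← riseProd, mul_one_div]
  field_simp

theorem tendsto_natCast_add_one_rpow_phi :
    Tendsto (fun n : ℕ => ((n + 1 : ℕ) : ℝ) ^ phi) atTop atTop :=
  (tendsto_rpow_atTop phi_pos).comp
    (tendsto_natCast_atTop_atTop.comp (tendsto_add_atTop_nat 1))

theorem isEquivalent_ev_length :
    (fun n : ℕ => (urnLaw n).ev fun x => (x.1 : ℝ) + x.2) ~[atTop]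
      (fun n : ℕ => (3 + √5) / (2 * √5) * ((n : ℝ) ^ phi / Real.Gamma phi)) := by
  have h5 : (√5 : ℝ) ^ 2 = 5 := Real.sq_sqrt (by norm_num)
  have hp := phi_pos
  have hG := Real.Gamma_pos_of_pos hp
  refine isEquivalent_of_tendsto_one ?_
  refine (tendsto_add_atTop_iff_nat 1).1 ?_
  have h1 := (tendsto_riseProd hp.le).const_mul ((3 + phi) / 5)
  have h2 : Tendsto (fun n : ℕ => riseProd (-(1 + phi)) n / ((n + 1 : ℕ) : ℝ) ^ phi) atTop
      (𝓝 0) :=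
    squeeze_zero_norm (fun n => by
      rw [norm_div, Real.norm_eq_abs, Real.norm_of_nonneg (by positivity)]
      gcongr
      exact abs_riseProd_neg_le n) (tendsto_natCast_add_one_rpow_phi.const_div_atTop 1)
  have h3 := (h1.add (h2.const_mul ((2 - phi) / 5))).const_mul
    ((3 + √5) / (2 * √5) / Real.Gamma phi)⁻¹
  have e1 : (3 + √5) / (2 * √5) * phi = (3 + phi) / 5 := by
    unfold phi; field_simp; linear_combination 3 * h5
  have e : ((3 + √5) / (2 * √5) / Real.Gamma phi)⁻¹ *
      ((3 + phi) / 5 * (1 / Real.Gamma (phi + 1)) + (2 - phi) / 5 * 0) = 1 := by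
    rw [Real.Gamma_add_one hp.ne', ← e1]
    field_simp
    ring
  rw [e] at h3
  refine h3.congr fun n => ?_
  have : 0 < ((n + 1 : ℕ) : ℝ) ^ phi := by positivity
  simp only [Pi.div_apply]
  rw [ev_length]
  field_simp

/-! ### Second moment of the minor part -/

theorem length_le_mainPart (x : ℕ × ℕ) : limitCoeff 1 * ((x.1 : ℝ) + x.2) ≤ mainPart x := by
  have := phi_pos
  have h1 := limitCoeff_nonneg 1
  have : 0 ≤ limitCoeff 1 * (phi * x.2) := by positivity
  unfold mainPart
  linarith

/-- The eigenvalue contributes a negative multiple of the square, which is dropped. The squared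
jumps (1 + φ)² and 1 contribute at most 4 (a + b), and c_1 ≥ 1/2 bounds this by eight times the main
part. -/
theorem generator_minorPart_sq_le (x : ℕ × ℕ) :
    generator (fun x => minorPart x ^ 2) x ≤ 8 * mainPart x := by
  have hp := phi_pos
  have hp1 := phi_lt_one
  have h1 := length_le_mainPart x
  have h2 : 1 / 2 ≤ limitCoeff 1 := by rw [limitCoeff_one]; linarith
  have h : generator (fun x => minorPart x ^ 2) x =
      -(2 * (1 + phi)) * minorPart x ^ 2 + ((1 + phi) ^ 2 * x.1 + x.2) := by
    obtain ⟨a, b⟩ := x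
    have := phi_sq
    cases a with
    | zero =>
      simp [generator, minorPart]
      linear_combination (2 * phi * b ^ 2) * phi_sq
    | succ a =>
      simp [generator, minorPart]
      linear_combination (2 * phi * b ^ 2 - 2 * (a + 1) * b : ℝ) * phi_sq
  rw [h]
  have ha : (0 : ℝ) ≤ x.1 := Nat.cast_nonneg _
  have hb : (0 : ℝ) ≤ x.2 := Nat.cast_nonneg _
  have h3 : (1 + phi) ^ 2 ≤ 4 := by nlinarith
  nlinarith [mul_nonneg (show 0 ≤ 2 * (1 + phi) by linarith) (sq_nonneg (minorPart x))]

/-- Since c_1 ≤ 2 φ, each increment is at most 16 φ `riseProd phi n` / (n + 1), exactly the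
increment of the right-hand side. -/
theorem ev_minorPart_sq_le (n : ℕ) :
    ((urnLaw (n + 1)).ev fun x => minorPart x ^ 2) ≤ 16 * riseProd phi n := by
  have hp := phi_pos
  have hp1 := half_lt_phi
  induction n with
  | zero => simp [ev_urnLaw_one, minorPart, riseProd]
  | succ n ih =>
    rw [ev_urnLaw_succ]
    calc _ ≤ (urnLaw (n + 1)).ev fun x => minorPart x ^ 2 + ((n : ℝ) + 1)⁻¹ * 8 * mainPart x := by
          refine PMF.ev_mono (finite_support_urnLaw _) fun x _ => ?_
          rw [smul_eq_mul, mul_assoc]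
          gcongr
          exact generator_minorPart_sq_le x
      _ = ((urnLaw (n + 1)).ev fun x => minorPart x ^ 2) +
          ((n : ℝ) + 1)⁻¹ * 8 * (riseProd phi n * limitCoeff 1) := by
          rw [PMF.ev_add (finite_support_urnLaw _), PMF.ev_const_mul (finite_support_urnLaw _),
            ev_urnLaw_of_generator generator_mainPart]
          simp [mainPart]
      _ ≤ 16 * riseProd phi n + ((n : ℝ) + 1)⁻¹ * 8 * (riseProd phi n * (2 * phi)) := by
          have := riseProd_pos hp.le n
          gcongr
          rw [limitCoeff_one]
          linarith [phi_lt_one]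
      _ = 16 * riseProd phi (n + 1) := by
          rw [riseProd, riseProd, Finset.prod_range_succ]
          field_simp
          ring

/-! ### Dominated convergence of the scaled generating function -/

theorem one_add_div_le_rpow {x : ℝ} (hx : 0 ≤ x) {n : ℕ} (hn : 0 < n) :
    (1 + x / (n + 1)) * (n : ℝ) ^ x ≤ ((n + 1 : ℕ) : ℝ) ^ x := by
  have hn' : (0 : ℝ) < n := by exact_mod_cast hn
  have h1 : 1 / ((n : ℝ) + 1) ≤ Real.log (((n + 1 : ℕ) : ℝ) / n) := by
    have := Real.one_sub_inv_le_log_of_pos (x := ((n + 1 : ℕ) : ℝ) / n) (by positivity)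
    refine le_trans (le_of_eq ?_) this
    push_cast
    field_simp
    ring
  have h2 : 1 + x / (n + 1) ≤ (((n + 1 : ℕ) : ℝ) / n) ^ x := by
    rw [Real.rpow_def_of_pos (by positivity)]
    calc 1 + x / ((n : ℝ) + 1) = 1 / ((n : ℝ) + 1) * x + 1 := by ring
      _ ≤ Real.log (((n + 1 : ℕ) : ℝ) / n) * x + 1 := by gcongr
      _ ≤ _ := Real.add_one_le_exp _
  rw [Real.div_rpow (by positivity) hn'.le, le_div_iff₀ (Real.rpow_pos_of_pos hn' _)] at h2
  exact h2

/-- The quotient decreases in n, so its value at one fixed q bounds all later ones, for every x at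
once. -/
theorem riseProd_div_le {x : ℝ} (hx : 0 ≤ x) {q n : ℕ} (hq : 0 < q) (hqn : q ≤ n) :
    riseProd x n / (n : ℝ) ^ x ≤ riseProd x q / (q : ℝ) ^ x := by
  induction n, hqn using Nat.le_induction with
  | base => exact le_rfl
  | succ n hn ih =>
    refine le_trans ?_ ih
    have hn0 : 0 < n := hq.trans_le hn
    have h1 := one_add_div_le_rpow hx hn0
    have h2 := riseProd_pos hx n
    have h3 : 0 < (n : ℝ) ^ x := Real.rpow_pos_of_pos (by exact_mod_cast hn0) _
    rw [div_le_div_iff₀ (by positivity) h3, riseProd, Finset.prod_range_succ, ← riseProd, mul_assoc]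
    gcongr

theorem riseProd_le_pow {x : ℝ} (hx : 0 ≤ x) (n : ℕ) : riseProd x n ≤ (1 + x) ^ n := by
  rw [← Finset.card_range n, ← Finset.prod_const, riseProd, Finset.card_range]
  refine Finset.prod_le_prod (fun _ _ => by positivity) fun k _ => ?_
  gcongr
  exact div_le_self hx (by linarith [Nat.cast_nonneg (α := ℝ) k])

theorem rpow_phi_pow (y : ℝ) (hy : 0 ≤ y) (r : ℕ) : (y ^ phi) ^ r = y ^ (r * phi) := by
  rw [mul_comm, Real.rpow_mul_natCast hy]

theorem summable_succ_pow_mul_half_pow (q : ℕ) :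
    Summable fun r : ℕ => ((r : ℝ) + 1) ^ q * (1 / 2) ^ r := by
  have h := (summable_nat_add_iff (f := fun r : ℕ => (r : ℝ) ^ q * (1 / 2 : ℝ) ^ r) 1).2 (summable_pow_mul_geometric_of_norm_lt_one q
    (show ‖(1 / 2 : ℝ)‖ < 1 by norm_num))
  refine (h.mul_left 2).congr fun r => ?_
  push_cast
  ring

/-- A bound, uniform in the size, on the terms of the scaled generating function. -/
theorem exists_term_bound (t : ℝ) (ht : 0 ≤ t) : ∃ q : ℕ, ∀ᶠ n : ℕ in atTop, ∀ r : ℕ,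
    limitCoeff r * riseProd (r * phi) n * (t / ((n + 1 : ℕ) : ℝ) ^ phi) ^ r ≤
      ((r : ℝ) + 1) ^ q * (1 / 2) ^ r := by
  have hp := phi_pos
  have h := (tendsto_rpow_atTop hp).comp tendsto_natCast_atTop_atTop
  -- Comparison with size q gives a polynomial in r times (t / (φ q^φ))^r; this q makes the ratio at
  -- most 1/2.
  obtain ⟨q, hq⟩ := ((h.eventually_ge_atTop (2 * (t * phi⁻¹))).and (eventually_gt_atTop 0)).exists
  obtain ⟨hq1, hq0⟩ := hq
  refine ⟨q, ?_⟩
  filter_upwards [eventually_ge_atTop q] with n hn r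
  have hx : 0 ≤ (r : ℝ) * phi := by positivity
  have hq0' : (0 : ℝ) < q := by exact_mod_cast hq0
  have hn0 : (0 : ℝ) < n := by exact_mod_cast hq0.trans_le hn
  have hqp : 0 < (q : ℝ) ^ phi := Real.rpow_pos_of_pos hq0' _
  have h1 : riseProd (r * phi) n / ((n + 1 : ℕ) : ℝ) ^ (r * phi) ≤
      (1 + r * phi) ^ q / (q : ℝ) ^ (r * phi) := by
    calc _ ≤ riseProd (r * phi) n / (n : ℝ) ^ (r * phi) := by
          refine div_le_div_of_nonneg_left (riseProd_pos hx n).le (Real.rpow_pos_of_pos hn0 _) ?_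
          exact Real.rpow_le_rpow hn0.le (by push_cast; linarith) hx
      _ ≤ riseProd (r * phi) q / (q : ℝ) ^ (r * phi) := riseProd_div_le hx hq0 hn
      _ ≤ _ := by
          gcongr
          exact riseProd_le_pow hx q
  calc _ = limitCoeff r * t ^ r * (riseProd (r * phi) n / ((n + 1 : ℕ) : ℝ) ^ (r * phi)) := by
        rw [div_pow, rpow_phi_pow _ (by positivity)]; ring
    _ ≤ (phi⁻¹) ^ r * t ^ r * ((1 + r * phi) ^ q / (q : ℝ) ^ (r * phi)) := by
        have := limitCoeff_le r
        have := riseProd_pos hx n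
        gcongr
    _ = (1 + r * phi) ^ q * (t * phi⁻¹ / (q : ℝ) ^ phi) ^ r := by
        rw [div_pow, mul_pow, rpow_phi_pow _ hq0'.le]; ring
    _ ≤ ((r : ℝ) + 1) ^ q * (1 / 2) ^ r := by
        have e1 : 1 + r * phi ≤ (r : ℝ) + 1 := by
          nlinarith [phi_lt_one, Nat.cast_nonneg (α := ℝ) r]
        have e2 : t * phi⁻¹ / (q : ℝ) ^ phi ≤ 1 / 2 := by
          rw [div_le_iff₀ hqp]
          simp only [Function.comp_apply] at hq1
          linarith
        exact mul_le_mul (pow_le_pow_left₀ (by positivity) e1 q)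
          (pow_le_pow_left₀ (by positivity) e2 r) (by positivity) (by positivity)

/-- The Taylor coefficients of the moment generating function of the limit law. -/
noncomputable def momentCoeff (r : ℕ) : ℝ := limitCoeff r / Real.Gamma (r * phi + 1)

theorem momentCoeff_nonneg (r : ℕ) : 0 ≤ momentCoeff r := by
  have hp := phi_pos
  exact div_nonneg (limitCoeff_nonneg r) (Real.Gamma_pos_of_pos (by positivity)).le

theorem tendsto_term (r : ℕ) : Tendsto (fun n : ℕ => limitCoeff r * riseProd (r * phi) n /
    (((n + 1 : ℕ) : ℝ) ^ phi) ^ r) atTop (𝓝 (momentCoeff r)) := by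
  have hp := phi_pos
  have h := (tendsto_riseProd (show 0 ≤ (r : ℝ) * phi by positivity)).const_mul (limitCoeff r)
  rw [mul_one_div] at h
  refine h.congr fun n => ?_
  rw [rpow_phi_pow _ (by positivity), mul_div_assoc]

theorem summable_momentCoeff {t : ℝ} (ht : 0 ≤ t) : Summable fun r => momentCoeff r * t ^ r := by
  obtain ⟨q, hq⟩ := exists_term_bound t ht
  refine (summable_succ_pow_mul_half_pow q).of_nonneg_of_le
    (fun r => mul_nonneg (momentCoeff_nonneg r) (by positivity)) fun r => ?_
  refine le_of_tendsto ((tendsto_term r).mul_const (t ^ r)) ?_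
  filter_upwards [hq] with n hn
  refine le_trans (le_of_eq ?_) (hn r)
  rw [div_pow]
  ring

/-- The moment generating function of the limit law. -/
noncomputable def limitMgf (z : ℂ) : ℂ := ∑' r, (momentCoeff r : ℂ) * z ^ r

theorem hasSum_limitMgf (z : ℂ) : HasSum (fun r => (momentCoeff r : ℂ) * z ^ r) (limitMgf z) := by
  refine Summable.hasSum (Summable.of_norm ?_)
  refine (summable_momentCoeff (norm_nonneg z)).congr fun r => ?_
  rw [norm_mul, norm_pow, Complex.norm_real, Real.norm_of_nonneg (momentCoeff_nonneg r)]

theorem tendsto_div_rpow_phi (θ : ℂ) :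
    Tendsto (fun n : ℕ => θ / ((((n + 1 : ℕ) : ℝ) ^ phi : ℝ) : ℂ)) atTop (𝓝 0) := by
  refine squeeze_zero_norm (fun n => ?_) (tendsto_natCast_add_one_rpow_phi.const_div_atTop ‖θ‖)
  rw [norm_div, Complex.norm_real, Real.norm_of_nonneg (by positivity)]

/-- The scaled generating function of the type counts. -/
noncomputable def scaledGen (n : ℕ) (θ : ℂ) : ℂ :=
  (urnLaw (n + 1)).ev fun x =>
    seriesEval seriesC (θ / ((((n + 1 : ℕ) : ℝ) ^ phi : ℝ) : ℂ)) ^ x.1 *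
      seriesEval seriesD (θ / ((((n + 1 : ℕ) : ℝ) ^ phi : ℝ) : ℂ)) ^ x.2

theorem tendsto_scaledGen (θ : ℂ) :
    Tendsto (fun n => scaledGen n θ) atTop (𝓝 (limitMgf θ)) := by
  obtain ⟨q, hq⟩ := exists_term_bound ‖θ‖ (norm_nonneg θ)
  have hsmall := (tendsto_div_rpow_phi θ).norm.eventually_lt_const
    (show ‖(0 : ℂ)‖ < phi by rw [norm_zero]; exact phi_pos)
  have hT := tendsto_tsum_of_dominated_convergence (summable_succ_pow_mul_half_pow q)
    (f := fun n r => ((limitCoeff r * riseProd (r * phi) n : ℝ) : ℂ) *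
      (θ / ((((n + 1 : ℕ) : ℝ) ^ phi : ℝ) : ℂ)) ^ r)
    (g := fun r => (momentCoeff r : ℂ) * θ ^ r) (𝓕 := atTop) ?_ ?_
  · refine hT.congr' ?_
    filter_upwards [hsmall] with n hn
    exact (hasSum_ev_urnLaw hn n).tsum_eq
  · intro r
    have h := ((Complex.continuous_ofReal.tendsto _).comp (tendsto_term r)).mul_const (θ ^ r)
    refine h.congr fun n => ?_
    simp only [Function.comp_apply]
    push_cast
    rw [div_pow]
    ring
  · filter_upwards [hq] with n hn r
    refine le_trans (le_of_eq ?_) (hn r)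
    have hp := phi_pos
    have h1 := limitCoeff_nonneg r
    have h2 := riseProd_pos (show 0 ≤ (r : ℝ) * phi by positivity) n
    rw [norm_mul, norm_pow, norm_div, Complex.norm_real, Complex.norm_real,
      Real.norm_of_nonneg (by positivity), Real.norm_of_nonneg (by positivity)]

/-! ### Comparison with exponentials -/

theorem exists_quadratic_bound (f : PowerSeries ℝ) (h0 : PowerSeries.coeff 0 f = 1)
    (h1 : |PowerSeries.coeff 1 f| ≤ 2)
    (hs : ∀ s : ℂ, ‖s‖ < phi →
      Summable fun r : ℕ => ‖((PowerSeries.coeff r f : ℝ) : ℂ) * s ^ r‖) :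
    ∃ K : ℝ, 0 ≤ K ∧ ∀ s : ℂ, ‖s‖ ≤ phi / 2 →
      ‖seriesEval f s - Complex.exp ((PowerSeries.coeff 1 f : ℝ) * s)‖ ≤ K * ‖s‖ ^ 2 := by
  have hp := phi_pos
  set a : ℕ → ℝ := fun r => PowerSeries.coeff r f with ha
  have hM : Summable fun r : ℕ => ‖((a (r + 2) : ℝ) : ℂ)‖ * (phi / 2) ^ r := by
    have h := (summable_nat_add_iff 2).2 (hs ((phi / 2 : ℝ) : ℂ)
      (by rw [Complex.norm_real, Real.norm_of_nonneg (by positivity)]; linarith))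
    refine (h.mul_right ((phi / 2) ^ 2)⁻¹).congr fun r => ?_
    rw [norm_mul, norm_pow, Complex.norm_real (phi / 2), Real.norm_of_nonneg (by positivity),
      pow_add]
    field_simp
    rfl
  -- The sum bounds the tail of f beyond the linear term. The 4 bounds the tail of the exponential:
  -- its argument has norm at most 2 |s| ≤ φ < 1.
  refine ⟨∑' r, ‖((a (r + 2) : ℝ) : ℂ)‖ * (phi / 2) ^ r + 4, by positivity, fun s hsn => ?_⟩
  have hsum := (hs s (by linarith)).of_norm
  have e : seriesEval f s = 1 + a 1 * s + ∑' r, ((a (r + 2) : ℝ) : ℂ) * s ^ (r + 2) := by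
    rw [seriesEval, ← hsum.sum_add_tsum_nat_add 2, Finset.sum_range_succ, Finset.sum_range_one,
      h0]
    simp [ha]
  have b1 : ‖∑' r, ((a (r + 2) : ℝ) : ℂ) * s ^ (r + 2)‖ ≤
      (∑' r, ‖((a (r + 2) : ℝ) : ℂ)‖ * (phi / 2) ^ r) * ‖s‖ ^ 2 := by
    rw [← tsum_mul_right]
    refine tsum_of_norm_bounded (hM.mul_right _).hasSum fun r => ?_
    rw [norm_mul, norm_pow, pow_add, ← mul_assoc]
    gcongr
  have hn : ‖((a 1 : ℝ) : ℂ) * s‖ ≤ 2 * ‖s‖ := by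
    rw [norm_mul, Complex.norm_real]
    gcongr
    exact h1
  have b2 := Complex.norm_exp_sub_one_sub_id_le
    (x := ((a 1 : ℝ) : ℂ) * s) (by linarith [phi_lt_one])
  have b3 : ‖((a 1 : ℝ) : ℂ) * s‖ ^ 2 ≤ 4 * ‖s‖ ^ 2 := by
    calc _ ≤ (2 * ‖s‖) ^ 2 := by gcongr
      _ = _ := by ring
  calc ‖seriesEval f s - Complex.exp ((a 1 : ℝ) * s)‖
      = ‖(∑' r, ((a (r + 2) : ℝ) : ℂ) * s ^ (r + 2)) -
          (Complex.exp ((a 1 : ℝ) * s) - 1 - (a 1 : ℝ) * s)‖ := by rw [e]; congr 1; ring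
    _ ≤ _ := (norm_sub_le _ _).trans (by rw [add_mul]; linarith)

/-- Exchange one factor at a time: the w's have modulus one and the z's at most 1 + δ, so each of
the a + b exchanges costs at most δ (1 + δ)^(a + b). -/
theorem norm_pow_mul_pow_sub_le {z₁ z₂ w₁ w₂ : ℂ} {δ : ℝ} (hδ : 0 ≤ δ) (h1 : ‖z₁ - w₁‖ ≤ δ)
    (h2 : ‖z₂ - w₂‖ ≤ δ) (hw1 : ‖w₁‖ = 1) (hw2 : ‖w₂‖ = 1) (a b : ℕ) :
    ‖z₁ ^ a * z₂ ^ b - w₁ ^ a * w₂ ^ b‖ ≤ ((a : ℝ) + b) * δ * (1 + δ) ^ (a + b) := by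
  have step : ∀ {z w Z W : ℂ} {L : ℝ} {k : ℕ}, ‖z - w‖ ≤ δ → ‖w‖ = 1 → ‖W‖ = 1 →
      ‖Z - W‖ ≤ L * δ * (1 + δ) ^ k → ‖z * Z - w * W‖ ≤ (L + 1) * δ * (1 + δ) ^ (k + 1) := by
    intro z w Z W L k hz hw hW hZ
    have hzn : ‖z‖ ≤ 1 + δ := by
      calc ‖z‖ = ‖w + (z - w)‖ := by congr 1; ring
        _ ≤ _ := (norm_add_le _ _).trans (by linarith)
    have hp : 1 ≤ (1 + δ) ^ (k + 1) := one_le_pow₀ (by linarith)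
    calc ‖z * Z - w * W‖ = ‖z * (Z - W) + (z - w) * W‖ := by congr 1; ring
      _ ≤ ‖z‖ * ‖Z - W‖ + ‖z - w‖ * ‖W‖ := by
          rw [← norm_mul, ← norm_mul]; exact norm_add_le _ _
      _ ≤ (1 + δ) * (L * δ * (1 + δ) ^ k) + δ * 1 := by
          rw [hW]; gcongr
      _ ≤ (1 + δ) * (L * δ * (1 + δ) ^ k) + δ * (1 + δ) ^ (k + 1) := by gcongr
      _ = _ := by ring
  have hb : ‖z₂ ^ b - w₂ ^ b‖ ≤ (b : ℝ) * δ * (1 + δ) ^ b := by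
    induction b with
    | zero => simp
    | succ b ih =>
      rw [pow_succ', pow_succ']
      push_cast
      exact step h2 hw2 (by simp [hw2]) ih
  induction a with
  | zero => simpa using hb
  | succ a ih =>
    rw [pow_succ', pow_succ', mul_assoc, mul_assoc]
    have := step h1 hw1 (by simp [hw1, hw2]) ih
    convert this using 2
    · push_cast; ring
    · congr 1; ring

theorem integral_pathLengthLaw {E : Type*} [NormedAddCommGroup E] [NormedSpace ℝ E]
    [CompleteSpace E] (n : ℕ) (F : ℕ → E) : Integrable F (pathLengthLaw n).toMeasure ∧
      ∫ l, F l ∂(pathLengthLaw n).toMeasure = (urnLaw n).ev fun x => F (x.1 + x.2) := by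
  rw [pathLengthLaw_eq]
  have h := PMF.integral_eq_ev
    (PMF.finite_support_map (fun x : ℕ × ℕ => x.1 + x.2) (finite_support_urnLaw n)) F
  refine ⟨h.1, h.2.trans ?_⟩
  rw [PMF.ev_map _ (finite_support_urnLaw n)]
  rfl

theorem one_add_le_seriesEval (f : PowerSeries ℝ) (h0 : PowerSeries.coeff 0 f = 1)
    (hf : ∀ r, 0 ≤ PowerSeries.coeff r f) {s : ℝ} (hs0 : 0 ≤ s)
    (hs : Summable fun r : ℕ => ‖((PowerSeries.coeff r f : ℝ) : ℂ) * (s : ℂ) ^ r‖) :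
    ∃ v : ℝ, seriesEval f s = v ∧ 1 + PowerSeries.coeff 1 f * s ≤ v := by
  have hs' : Summable fun r : ℕ => PowerSeries.coeff r f * s ^ r := by
    refine hs.congr fun r => ?_
    rw [norm_mul, norm_pow, Complex.norm_real, Complex.norm_real, Real.norm_of_nonneg (hf r),
      Real.norm_of_nonneg hs0]
  refine ⟨∑' r, PowerSeries.coeff r f * s ^ r, ?_, ?_⟩
  · rw [seriesEval, Complex.ofReal_tsum]
    push_cast
    rfl
  · have := hs'.sum_le_tsum (Finset.range 2) fun r _ => mul_nonneg (hf r) (by positivity)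
    rw [Finset.sum_range_succ, Finset.sum_range_one, h0] at this
    simpa using this

theorem seriesC_coeff (r : ℕ) : PowerSeries.coeff r seriesC = limitCoeff r := by
  rw [seriesC, PowerSeries.coeff_mk]

theorem seriesD_coeff (r : ℕ) : PowerSeries.coeff r seriesD = (1 + r * phi) * limitCoeff r := by
  rw [seriesD, PowerSeries.coeff_mk]

/-- Exponential moments of the scaled length stay bounded. -/
theorem exists_exp_bound (t : ℝ) (ht : 0 ≤ t) : ∃ B : ℝ, ∀ᶠ n : ℕ in atTop,
    ((urnLaw (n + 1)).ev fun x =>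
      Real.exp (t * (((x.1 : ℝ) + x.2) / ((n + 1 : ℕ) : ℝ) ^ phi))) ≤ B := by
  have hp := phi_pos
  have hp1 := phi_lt_one
  have hc : 1 / 2 ≤ limitCoeff 1 := by rw [limitCoeff_one]; linarith
  have hc1 : limitCoeff 1 ≤ 1 := by rw [limitCoeff_one]; linarith
  -- With s = 4 z and c_1 ≥ 1/2 one has 1 + c_1 s ≥ 1 + 2 z ≥ 1 + z + z² ≥ exp z for 0 ≤ z ≤ 1.
  -- Hence exp z is at most C(s) and D(s), and the convergent scaled generating function bounds the
  -- exponential moment.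
  set θ : ℝ := 4 * t with hθ
  have hθ0 : 0 ≤ θ := by positivity
  have hsmall := (tendsto_div_rpow_phi θ).norm.eventually_lt_const
    (show ‖(0 : ℂ)‖ < phi by rw [norm_zero]; exact phi_pos)
  have hbdd := (tendsto_scaledGen θ).norm.eventually_le_const
    (show ‖limitMgf θ‖ < ‖limitMgf θ‖ + 1 by linarith)
  refine ⟨‖limitMgf θ‖ + 1, ?_⟩
  filter_upwards [hsmall, hbdd] with n hn hB
  refine le_trans ?_ hB
  have hN : 0 < ((n + 1 : ℕ) : ℝ) ^ phi := by positivity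
  set N := ((n + 1 : ℕ) : ℝ) ^ phi with hNdef
  set s : ℝ := θ / N with hs
  have hs0 : 0 ≤ s := by positivity
  have hse : (θ : ℂ) / (N : ℂ) = (s : ℂ) := by rw [hs]; push_cast; rfl
  rw [hse] at hn
  have hsp : s < phi := by
    rwa [Complex.norm_real, Real.norm_of_nonneg hs0] at hn
  obtain ⟨u, hu, hu1⟩ := one_add_le_seriesEval seriesC (by rw [seriesC_coeff, limitCoeff_zero])
    (fun r => by rw [seriesC_coeff]; exact limitCoeff_nonneg r) hs0 (summable_seriesC hn)
  obtain ⟨v, hv, hv1⟩ := one_add_le_seriesEval seriesD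
    (by rw [seriesD_coeff, limitCoeff_zero]; simp)
    (fun r => by rw [seriesD_coeff]; exact mul_nonneg (by positivity) (limitCoeff_nonneg r)) hs0
    (summable_seriesD hn)
  rw [seriesC_coeff] at hu1
  rw [seriesD_coeff, Nat.cast_one, one_mul] at hv1
  have key : ∀ y : ℝ, 1 + limitCoeff 1 * s ≤ y → Real.exp (t / N) ≤ y := by
    intro y hy
    refine le_trans ?_ hy
    have hz0 : 0 ≤ t / N := by positivity
    have hst : s = 4 * (t / N) := by rw [hs, hθ]; ring
    have hz1 : t / N ≤ 1 := by linarith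
    have h := abs_le.1 (Real.norm_exp_sub_one_sub_id_le (x := t / N)
      (by rwa [Real.norm_of_nonneg hz0]))
    rw [Real.norm_of_nonneg hz0] at h
    rw [hst]
    nlinarith [h.2]
  have hu2 := key u hu1
  have hv2 := key v (hv1.trans' (by nlinarith [mul_nonneg (mul_nonneg hp.le (by linarith : 0 ≤ limitCoeff 1)) hs0]))
  have e : scaledGen n θ = (((urnLaw (n + 1)).ev fun x => u ^ x.1 * v ^ x.2 : ℝ) : ℂ) := by
    have := ev_ofReal_mul (finite_support_urnLaw (n + 1)) (fun x => u ^ x.1 * v ^ x.2) 1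
    rw [mul_one] at this
    rw [← this, scaledGen, hse, hu, hv]
    push_cast
    simp
  rw [e, Complex.norm_real]
  refine le_trans ?_ (le_abs_self _)
  refine PMF.ev_mono (finite_support_urnLaw _) fun x _ => ?_
  calc Real.exp (t * (((x.1 : ℝ) + x.2) / N)) = Real.exp (t / N) ^ x.1 * Real.exp (t / N) ^ x.2 := by
        rw [← Real.exp_nat_mul, ← Real.exp_nat_mul, ← Real.exp_add]
        congr 1
        ring
    _ ≤ u ^ x.1 * v ^ x.2 := by
        have hu0 : 0 ≤ u := (Real.exp_pos _).le.trans hu2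
        gcongr

/-! ### Convergence of characteristic functions -/

/-- The characteristic function of the dominant linear part of the type counts. -/
theorem tendsto_exp_mainPart (ξ : ℝ) : Tendsto (fun n : ℕ => (urnLaw (n + 1)).ev fun x =>
    Complex.exp (((ξ / ((n + 1 : ℕ) : ℝ) ^ phi * mainPart x : ℝ) : ℂ) * Complex.I)) atTop
      (𝓝 (limitMgf (ξ * Complex.I))) := by
  have hp := phi_pos
  have hp1 := phi_lt_one
  have hc : 0 ≤ limitCoeff 1 := limitCoeff_nonneg 1
  have hc1 : limitCoeff 1 ≤ 1 := by rw [limitCoeff_one]; linarith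
  obtain ⟨K₁, hK₁, h₁⟩ := exists_quadratic_bound seriesC (by rw [seriesC_coeff, limitCoeff_zero])
    (by rw [seriesC_coeff, abs_of_nonneg hc]; linarith) fun s hs => summable_seriesC hs
  obtain ⟨K₂, hK₂, h₂⟩ := exists_quadratic_bound seriesD
    (by rw [seriesD_coeff, limitCoeff_zero]; simp)
    (by rw [seriesD_coeff, abs_of_nonneg (by positivity)]; push_cast; nlinarith)
    fun s hs => summable_seriesD hs
  set K := max K₁ K₂ with hK
  have hK0 : 0 ≤ K := hK₁.trans (le_max_left _ _)
  have hs0 := (tendsto_div_rpow_phi (ξ * Complex.I)).norm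
  rw [norm_zero] at hs0
  have hsmall := hs0.eventually_le_const (show 0 < phi / 2 by positivity)
  have hsmall' := (hs0.const_mul K).eventually_le_const (show K * 0 < 1 by simp)
  -- The error of the exponential approximation is at most K |s| (|s| L) exp(|s| L) ≤ K |s| exp(2
  -- |s| L), where |s| = |ξ| / N.
  obtain ⟨B, hB⟩ := exists_exp_bound (2 * |ξ|) (by positivity)
  have hlim : Tendsto (fun n : ℕ =>
      K * ‖(ξ * Complex.I) / ((((n + 1 : ℕ) : ℝ) ^ phi : ℝ) : ℂ)‖ * B) atTop (𝓝 0) := by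
    simpa using (hs0.const_mul K).mul_const B
  have hG := tendsto_scaledGen (ξ * Complex.I)
  rw [← sub_zero (limitMgf _)]
  suffices h : Tendsto (fun n : ℕ => scaledGen n (ξ * Complex.I) -
      (urnLaw (n + 1)).ev fun x =>
        Complex.exp (((ξ / ((n + 1 : ℕ) : ℝ) ^ phi * mainPart x : ℝ) : ℂ) * Complex.I))
      atTop (𝓝 0) by
    exact (hG.sub h).congr fun n => by ring
  refine squeeze_zero_norm' ?_ hlim
  filter_upwards [hsmall, hsmall', hB] with n hn hn' hBn
  have hN : 0 < ((n + 1 : ℕ) : ℝ) ^ phi := by positivity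
  set N := ((n + 1 : ℕ) : ℝ) ^ phi with hNdef
  set s : ℂ := (ξ * Complex.I) / (N : ℂ) with hs
  have hsn : ‖s‖ = |ξ| / N := by
    rw [hs, norm_div, norm_mul, Complex.norm_I, Complex.norm_real, Complex.norm_real, mul_one,
      Real.norm_eq_abs, Real.norm_of_nonneg hN.le]
  have hexp : ∀ c : ℝ, ‖Complex.exp (c * s)‖ = 1 := by
    intro c
    rw [show (c : ℂ) * s = ((c * (ξ / N) : ℝ) : ℂ) * Complex.I by rw [hs]; push_cast; ring]
    exact Complex.norm_exp_ofReal_mul_I _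
  set δ := K * ‖s‖ ^ 2 with hδ
  have hδ0 : 0 ≤ δ := by positivity
  have hδs : δ ≤ ‖s‖ := by
    calc δ = K * ‖s‖ * ‖s‖ := by rw [hδ]; ring
      _ ≤ 1 * ‖s‖ := by gcongr
      _ = _ := one_mul _
  rw [scaledGen, ← PMF.ev_sub (finite_support_urnLaw _)]
  refine (PMF.norm_ev_le (finite_support_urnLaw _) _).trans ?_
  calc _ ≤ (urnLaw (n + 1)).ev fun x =>
        K * ‖s‖ * Real.exp (2 * |ξ| * (((x.1 : ℝ) + x.2) / N)) := by
        refine PMF.ev_mono (finite_support_urnLaw _) fun x _ => ?_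
        have hx : Complex.exp (((ξ / N * mainPart x : ℝ) : ℂ) * Complex.I) =
            Complex.exp ((PowerSeries.coeff 1 seriesC : ℝ) * s) ^ x.1 *
              Complex.exp ((PowerSeries.coeff 1 seriesD : ℝ) * s) ^ x.2 := by
          rw [← Complex.exp_nat_mul, ← Complex.exp_nat_mul, ← Complex.exp_add, seriesC_coeff,
            seriesD_coeff, mainPart, hs]
          congr 1
          push_cast
          ring
        rw [hx]
        refine (norm_pow_mul_pow_sub_le hδ0
          ((h₁ s hn).trans (mul_le_mul_of_nonneg_right (le_max_left _ _) (by positivity)))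
          ((h₂ s hn).trans (mul_le_mul_of_nonneg_right (le_max_right _ _) (by positivity))) (hexp _) (hexp _) _ _).trans ?_
        have hL : (0 : ℝ) ≤ (x.1 : ℝ) + x.2 := by positivity
        set L : ℝ := (x.1 : ℝ) + x.2 with hLdef
        have e1 : (1 + δ) ^ (x.1 + x.2) ≤ Real.exp (‖s‖ * L) := by
          calc (1 + δ) ^ (x.1 + x.2) ≤ Real.exp ‖s‖ ^ (x.1 + x.2) := by
                gcongr
                linarith [Real.add_one_le_exp ‖s‖]
            _ = _ := by
                rw [← Real.exp_nat_mul, hLdef]; push_cast; congr 1; ring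
        have e2 : ‖s‖ * L ≤ Real.exp (‖s‖ * L) := by linarith [Real.add_one_le_exp (‖s‖ * L)]
        calc L * δ * (1 + δ) ^ (x.1 + x.2) = K * ‖s‖ * ((‖s‖ * L) * (1 + δ) ^ (x.1 + x.2)) := by
              rw [hδ]; ring
          _ ≤ K * ‖s‖ * (Real.exp (‖s‖ * L) * Real.exp (‖s‖ * L)) := by gcongr
          _ = _ := by
              rw [← Real.exp_add, hsn]
              congr 2
              ring
    _ = K * ‖s‖ * _ := PMF.ev_const_mul (finite_support_urnLaw _) _ _
    _ ≤ K * ‖s‖ * B := by gcongr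

/-- From |m| ≤ √N + m² / √N and E m² = O(N) the expectation of |m| is O(√N), where N = (n + 1)^φ. -/
theorem tendsto_ev_abs_minorPart : Tendsto (fun n : ℕ =>
    ((urnLaw (n + 1)).ev fun x => |minorPart x|) / ((n + 1 : ℕ) : ℝ) ^ phi) atTop (𝓝 0) := by
  have h1 := ((tendsto_riseProd phi_pos.le).const_mul 16).const_add 1
  have h3 := (Real.tendsto_sqrt_atTop.comp tendsto_natCast_add_one_rpow_phi).inv_tendsto_atTop
  have h4 := h3.mul h1
  rw [zero_mul] at h4
  refine squeeze_zero (fun n => ?_) (fun n => ?_) h4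
  · have : 0 ≤ (urnLaw (n + 1)).ev fun x => |minorPart x| := by
      have := PMF.ev_mono (finite_support_urnLaw (n + 1)) (f := fun _ => (0 : ℝ))
        (g := fun x => |minorPart x|) fun x _ => abs_nonneg _
      rwa [PMF.ev_const (finite_support_urnLaw _)] at this
    positivity
  · have hN : 0 < ((n + 1 : ℕ) : ℝ) ^ phi := by positivity
    simp only [Pi.inv_apply, Function.comp_apply]
    set N := ((n + 1 : ℕ) : ℝ) ^ phi with hNdef
    have hq : 0 < √N := Real.sqrt_pos.2 hN
    have hqq : √N * √N = N := Real.mul_self_sqrt hN.le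
    have hb : ((urnLaw (n + 1)).ev fun x => |minorPart x|) ≤
        √N + (√N)⁻¹ * (16 * riseProd phi n) := by
      calc _ ≤ (urnLaw (n + 1)).ev fun x => √N + (√N)⁻¹ * minorPart x ^ 2 := by
            refine PMF.ev_mono (finite_support_urnLaw _) fun x _ => ?_
            have h : |minorPart x| * √N ≤ N + minorPart x ^ 2 := by
              nlinarith [sq_nonneg (|minorPart x| - √N), sq_abs (minorPart x),
                sq_nonneg (minorPart x)]
            calc |minorPart x| = (√N)⁻¹ * (|minorPart x| * √N) := by field_simp
              _ ≤ (√N)⁻¹ * (N + minorPart x ^ 2) := by gcongr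
              _ = _ := by
                rw [mul_add]
                congr 1
                exact (inv_mul_eq_iff_eq_mul₀ hq.ne').2 hqq.symm
        _ = √N + (√N)⁻¹ * ((urnLaw (n + 1)).ev fun x => minorPart x ^ 2) := by
            rw [PMF.ev_add (finite_support_urnLaw _), PMF.ev_const (finite_support_urnLaw _),
              PMF.ev_const_mul (finite_support_urnLaw _)]
        _ ≤ _ := by
            gcongr
            exact ev_minorPart_sq_le n
    calc _ ≤ (√N + (√N)⁻¹ * (16 * riseProd phi n)) / N := by gcongr
      _ = _ := by
        rw [add_div, mul_add, mul_one]
        congr 1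
        · rw [div_eq_iff hN.ne']
          exact ((inv_mul_eq_iff_eq_mul₀ hq.ne').2 hqq.symm).symm
        · ring

/-- The length differs from the main part by a multiple of the minor part, and |e^{iu} - 1| ≤ |u|
turns this into the expectation of the previous limit. -/
theorem tendsto_exp_length (ξ : ℝ) : Tendsto (fun n : ℕ => (urnLaw (n + 1)).ev fun x =>
    Complex.exp (((ξ * (((x.1 : ℝ) + x.2) / ((n + 1 : ℕ) : ℝ) ^ phi) : ℝ) : ℂ) * Complex.I)) atTop
      (𝓝 (limitMgf (ξ * Complex.I))) := by
  have hp := phi_pos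
  have hp1 := phi_lt_one
  rw [← add_zero (limitMgf _)]
  have hlim := tendsto_ev_abs_minorPart.const_mul |ξ|
  rw [mul_zero] at hlim
  suffices h : Tendsto (fun n : ℕ => ((urnLaw (n + 1)).ev fun x =>
      Complex.exp (((ξ * (((x.1 : ℝ) + x.2) / ((n + 1 : ℕ) : ℝ) ^ phi) : ℝ) : ℂ) * Complex.I)) -
      (urnLaw (n + 1)).ev fun x =>
        Complex.exp (((ξ / ((n + 1 : ℕ) : ℝ) ^ phi * mainPart x : ℝ) : ℂ) * Complex.I))
      atTop (𝓝 0) by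
    exact ((tendsto_exp_mainPart ξ).add h).congr fun n => by ring
  refine squeeze_zero_norm (fun n => ?_) hlim
  have hN : 0 < ((n + 1 : ℕ) : ℝ) ^ phi := by positivity
  set N := ((n + 1 : ℕ) : ℝ) ^ phi with hNdef
  rw [← PMF.ev_sub (finite_support_urnLaw _)]
  refine (PMF.norm_ev_le (finite_support_urnLaw _) _).trans ?_
  rw [← mul_div_assoc, mul_div_right_comm, ← PMF.ev_const_mul (finite_support_urnLaw _)]
  refine PMF.ev_mono (finite_support_urnLaw _) fun x _ => ?_
  have e : Complex.exp (((ξ * (((x.1 : ℝ) + x.2) / N) : ℝ) : ℂ) * Complex.I) -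
      Complex.exp (((ξ / N * mainPart x : ℝ) : ℂ) * Complex.I) =
      Complex.exp (((ξ / N * mainPart x : ℝ) : ℂ) * Complex.I) *
        (Complex.exp (Complex.I * ((ξ / N * ((2 - phi) / 5 * minorPart x) : ℝ) : ℂ)) - 1) := by
    rw [mul_sub, mul_one, ← Complex.exp_add, length_eq_parts]
    congr 2
    push_cast
    ring
  rw [e, norm_mul, Complex.norm_exp_ofReal_mul_I, one_mul]
  refine Real.norm_exp_I_mul_ofReal_sub_one_le.trans ?_
  rw [norm_mul, norm_mul, norm_div, Real.norm_eq_abs, Real.norm_of_nonneg hN.le,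
    Real.norm_of_nonneg (by linarith : 0 ≤ (2 - phi) / 5), Real.norm_eq_abs]
  gcongr
  have := abs_nonneg (minorPart x)
  nlinarith

/-! ### Moments and characteristic functions -/

/-- The formal power series in a real variable with the complex coefficients `a r`. -/
noncomputable def scalarSeries (a : ℕ → ℂ) : FormalMultilinearSeries ℝ ℝ ℂ :=
  fun r => ContinuousMultilinearMap.mkPiRing ℝ (Fin r) (a r)

theorem scalarSeries_coeff (a : ℕ → ℂ) (r : ℕ) : (scalarSeries a).coeff r = a r := by
  simp [scalarSeries, FormalMultilinearSeries.coeff]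

theorem hasFPowerSeriesAt_of_hasSum {f : ℝ → ℂ} {a : ℕ → ℂ}
    (h : ∀ ξ : ℝ, HasSum (fun r => ((ξ : ℂ) * Complex.I) ^ r * a r) (f ξ)) :
    HasFPowerSeriesAt f (scalarSeries fun r => Complex.I ^ r * a r) 0 := by
  refine hasFPowerSeriesAt_iff.2 (.of_forall fun ξ => ?_)
  rw [zero_add]
  refine (h ξ).congr_fun fun r => ?_
  rw [scalarSeries_coeff, Complex.real_smul, mul_pow, mul_assoc, Complex.ofReal_pow]

theorem coeff_unique_of_hasSum {f : ℝ → ℂ} {a b : ℕ → ℂ}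
    (ha : ∀ ξ : ℝ, HasSum (fun r => ((ξ : ℂ) * Complex.I) ^ r * a r) (f ξ))
    (hb : ∀ ξ : ℝ, HasSum (fun r => ((ξ : ℂ) * Complex.I) ^ r * b r) (f ξ)) (r : ℕ) :
    a r = b r := by
  have h := (hasFPowerSeriesAt_of_hasSum ha).eq_formalMultilinearSeries
    (hasFPowerSeriesAt_of_hasSum hb)
  have h' := congrArg (fun p : FormalMultilinearSeries ℝ ℝ ℂ => p.coeff r) h
  simpa [scalarSeries_coeff] using h'

theorem integrable_pow_of_exp {μ : Measure ℝ}
    (h : ∀ t : ℝ, Integrable (fun x => Real.exp (t * |x|)) μ) (r : ℕ) :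
    Integrable (fun x : ℝ => x ^ r) μ := by
  refine ((h 1).const_mul (r.factorial : ℝ)).mono' (by fun_prop) (.of_forall fun x => ?_)
  have := Real.pow_div_factorial_le_exp |x| (abs_nonneg x) r
  rw [div_le_iff₀ (by positivity)] at this
  rw [norm_pow, Real.norm_eq_abs, one_mul]
  linarith

theorem hasSum_charFun {μ : Measure ℝ} (h : ∀ t : ℝ, Integrable (fun x => Real.exp (t * |x|)) μ)
    (ξ : ℝ) : HasSum (fun r : ℕ => ((ξ : ℂ) * Complex.I) ^ r *
      (((∫ x, x ^ r ∂μ) / r.factorial : ℝ) : ℂ)) (charFun μ ξ) := by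
  have hs : ∀ x : ℝ, HasSum (fun r : ℕ => |ξ * x| ^ r / r.factorial) (Real.exp (|ξ| * |x|)) := by
    intro x
    rw [← abs_mul, Real.exp_eq_exp_ℝ]
    exact NormedSpace.expSeries_div_hasSum_exp _
  rw [charFun_apply_real]
  have := hasSum_integral_of_dominated_convergence (μ := μ)
    (F := fun (r : ℕ) (x : ℝ) => ((ξ : ℂ) * x * Complex.I) ^ r / r.factorial)
    (f := fun x : ℝ => Complex.exp (ξ * x * Complex.I))
    (fun r x => |ξ * x| ^ r / r.factorial) (fun r => by fun_prop)
    (fun r => .of_forall fun x => by simp [abs_mul, mul_pow])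
    (.of_forall fun x => (hs x).summable) ?_ (.of_forall fun x => ?_)
  · refine this.congr_fun fun r => ?_
    have e : ∀ x : ℝ, ((ξ : ℂ) * x * Complex.I) ^ r / r.factorial =
        ((ξ : ℂ) * Complex.I) ^ r * (((r.factorial : ℝ)⁻¹ * x ^ r : ℝ) : ℂ) := by
      intro x; push_cast; ring
    simp only [e]
    rw [integral_const_mul, integral_complex_ofReal, integral_const_mul, div_eq_inv_mul]
  · simpa only [fun x => (hs x).tsum_eq] using h |ξ|
  · rw [Complex.exp_eq_exp_ℂ]
    exact NormedSpace.expSeries_div_hasSum_exp _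

/-- Even powers are nonnegative, so the series of cosh can be integrated term by term; its value is
an even part of the convergent series of M. Then exp(t |x|) ≤ 2 cosh(t x). -/
theorem integrable_exp_of_moments {μ : Measure ℝ}
    (h : ∀ r : ℕ, Integrable (fun x : ℝ => x ^ r) μ ∧
      ∫ x, x ^ r ∂μ = r.factorial * momentCoeff r) (t : ℝ) :
    Integrable (fun x => Real.exp (t * |x|)) μ := by
  have hterm : ∀ k : ℕ, ∫⁻ x, ENNReal.ofReal ((t * x) ^ (2 * k) / (2 * k).factorial) ∂μ =
      ENNReal.ofReal (momentCoeff (2 * k) * |t| ^ (2 * k)) := by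
    intro k
    have e : ∀ x : ℝ, (t * x) ^ (2 * k) / (2 * k).factorial =
        t ^ (2 * k) / (2 * k).factorial * x ^ (2 * k) := by intro x; rw [mul_pow]; ring
    rw [← ofReal_integral_eq_lintegral_ofReal]
    · congr 1
      simp only [e]
      rw [integral_const_mul, (h (2 * k)).2, Even.pow_abs (even_two_mul k)]
      have : ((2 * k).factorial : ℝ) ≠ 0 := by positivity
      field_simp
    · simp only [e]
      exact (h (2 * k)).1.const_mul _
    · exact .of_forall fun x => div_nonneg ((even_two_mul k).pow_nonneg _) (by positivity)
  have hsum : Summable fun k : ℕ => momentCoeff (2 * k) * |t| ^ (2 * k) :=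
    (summable_momentCoeff (abs_nonneg t)).comp_injective
      (i := fun k : ℕ => 2 * k) (fun a b hab => by simpa using hab)
  have hcosh : Integrable (fun x => Real.cosh (t * x)) μ := by
    refine ⟨by fun_prop, ?_⟩
    rw [hasFiniteIntegral_iff_ofReal (.of_forall fun x => (Real.cosh_pos _).le)]
    have e : ∀ x : ℝ, ENNReal.ofReal (Real.cosh (t * x)) =
        ∑' k : ℕ, ENNReal.ofReal ((t * x) ^ (2 * k) / (2 * k).factorial) := by
      intro x
      rw [← (Real.hasSum_cosh (t * x)).tsum_eq, ENNReal.ofReal_tsum_of_nonneg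
        (fun k => div_nonneg ((even_two_mul k).pow_nonneg _) (by positivity))
        (Real.hasSum_cosh (t * x)).summable]
    simp only [e]
    rw [lintegral_tsum (fun k => by fun_prop)]
    simp only [hterm]
    rw [← ENNReal.ofReal_tsum_of_nonneg
      (fun k => mul_nonneg (momentCoeff_nonneg _) (by positivity)) hsum]
    exact ENNReal.ofReal_lt_top
  refine (hcosh.const_mul 2).mono' (by fun_prop) (.of_forall fun x => ?_)
  rw [Real.norm_of_nonneg (Real.exp_pos _).le, Real.cosh_eq]
  have h1 : Real.exp (t * |x|) ≤ Real.exp (t * x) + Real.exp (-(t * x)) := by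
    rcases abs_choice x with hx | hx
    · rw [hx]; linarith [Real.exp_pos (-(t * x))]
    · rw [hx, mul_neg]; linarith [Real.exp_pos (t * x)]
  linarith

theorem hasSum_limitMgf_mul_I (ξ : ℝ) :
    HasSum (fun r => ((ξ : ℂ) * Complex.I) ^ r * (momentCoeff r : ℂ))
      (limitMgf (ξ * Complex.I)) := by
  simpa only [mul_comm] using hasSum_limitMgf (ξ * Complex.I)

/-- This settles the moment problem: the moments force all exponential moments to exist, hence the
characteristic function to equal its moment series. -/
theorem charFun_of_moments {μ : Measure ℝ}
    (h : ∀ r : ℕ, Integrable (fun x : ℝ => x ^ r) μ ∧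
      ∫ x, x ^ r ∂μ = r.factorial * momentCoeff r) (ξ : ℝ) :
    charFun μ ξ = limitMgf (ξ * Complex.I) := by
  refine (hasSum_charFun (integrable_exp_of_moments h) ξ).unique ?_
  refine (hasSum_limitMgf_mul_I ξ).congr_fun fun r => ?_
  rw [(h r).2, mul_div_cancel_left₀ _ (by positivity)]

theorem moments_of_charFun {μ : Measure ℝ}
    (h : ∀ t : ℝ, Integrable (fun x => Real.exp (t * |x|)) μ)
    (hμ : ∀ ξ : ℝ, charFun μ ξ = limitMgf (ξ * Complex.I)) (r : ℕ) :
    Integrable (fun x : ℝ => x ^ r) μ ∧ ∫ x, x ^ r ∂μ = r.factorial * momentCoeff r := by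
  refine ⟨integrable_pow_of_exp h r, ?_⟩
  have := coeff_unique_of_hasSum (hasSum_charFun h)
    (fun ξ => (hμ ξ) ▸ hasSum_limitMgf_mul_I ξ) r
  have := Complex.ofReal_injective this
  rw [div_eq_iff (by positivity)] at this
  rw [this, mul_comm]

/-! ### The limit law -/

/-- The law of `L_n / n ^ φ`. -/
noncomputable def scaledLaw (n : ℕ) : ProbabilityMeasure ℝ :=
  ⟨(pathLengthLaw n).toMeasure.map fun l : ℕ => (l : ℝ) / (n : ℝ) ^ phi,
    Measure.isProbabilityMeasure_map (measurable_of_countable _).aemeasurable⟩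

theorem integral_scaledLaw {E : Type*} [NormedAddCommGroup E] [NormedSpace ℝ E]
    [CompleteSpace E] (n : ℕ) {F : ℝ → E} (hF : Continuous F) :
    Integrable F (scaledLaw n : Measure ℝ) ∧ ∫ y, F y ∂(scaledLaw n : Measure ℝ) =
      (urnLaw n).ev fun x => F (((x.1 : ℝ) + x.2) / (n : ℝ) ^ phi) := by
  have h := integral_pathLengthLaw n fun l : ℕ => F ((l : ℝ) / (n : ℝ) ^ phi)
  have hm : AEMeasurable (fun l : ℕ => (l : ℝ) / (n : ℝ) ^ phi) (pathLengthLaw n).toMeasure :=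
    (measurable_of_countable _).aemeasurable
  change Integrable F ((pathLengthLaw n).toMeasure.map _) ∧
    ∫ y, F y ∂((pathLengthLaw n).toMeasure.map _) = _
  rw [integrable_map_measure hF.aestronglyMeasurable hm,
    integral_map hm hF.aestronglyMeasurable]
  refine ⟨h.1, h.2.trans ?_⟩
  push_cast
  rfl

theorem tendsto_charFun_scaledLaw (ξ : ℝ) :
    Tendsto (fun n => charFun (scaledLaw (n + 1) : Measure ℝ) ξ) atTop
      (𝓝 (limitMgf (ξ * Complex.I))) := by
  refine (tendsto_exp_length ξ).congr fun n => ?_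
  rw [charFun_apply_real, (integral_scaledLaw (n + 1) (by fun_prop)).2]
  push_cast
  rfl

theorem exists_limit_law : ∃ μ : ProbabilityMeasure ℝ,
    Tendsto scaledLaw atTop (𝓝 μ) ∧ ∀ r : ℕ, Integrable (fun x : ℝ => x ^ r) (μ : Measure ℝ) ∧
      ∫ x, x ^ r ∂(μ : Measure ℝ) = r.factorial * momentCoeff r := by
  -- Lévy's continuity argument: a limit of characteristic functions that is continuous at 0 makes
  -- the laws tight, so some subsequence converges; its limit has characteristic function M(iξ),
  -- which identifies the limit of the whole sequence.
  have hcont : ContinuousAt (fun ξ : ℝ => limitMgf (ξ * Complex.I)) 0 :=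
    (hasFPowerSeriesAt_of_hasSum hasSum_limitMgf_mul_I).continuousAt
  have htight := isTightMeasureSet_of_tendsto_charFun hcont tendsto_charFun_scaledLaw
  have hcomp : IsCompact (closure (Set.range fun n => scaledLaw (n + 1))) := by
    refine isCompact_closure_of_isTightMeasureSet ?_
    convert htight using 1
    ext ν
    simp
  obtain ⟨μ, -, ψ, hψ, hlim⟩ := hcomp.tendsto_subseq (x := fun n => scaledLaw (n + 1))
    fun n => subset_closure ⟨n, rfl⟩
  have hchar : ∀ ξ : ℝ, charFun (μ : Measure ℝ) ξ = limitMgf (ξ * Complex.I) := fun ξ =>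
    tendsto_nhds_unique (ProbabilityMeasure.tendsto_iff_tendsto_charFun.1 hlim ξ)
      ((tendsto_charFun_scaledLaw ξ).comp hψ.tendsto_atTop)
  have htend : Tendsto (fun n => scaledLaw (n + 1)) atTop (𝓝 μ) := by
    refine ProbabilityMeasure.tendsto_of_tendsto_charFun fun ξ => ?_
    rw [hchar]
    exact tendsto_charFun_scaledLaw ξ
  -- Weak convergence bounds the integral of a nonnegative continuous function by the lower limit of
  -- the integrals, so the uniform exponential bound passes to the limit law.
  have hexp : ∀ t : ℝ, 0 ≤ t → Integrable (fun x => Real.exp (t * |x|)) (μ : Measure ℝ) := by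
    intro t ht
    obtain ⟨B, hB⟩ := exists_exp_bound t ht
    refine ⟨by fun_prop, ?_⟩
    rw [hasFiniteIntegral_iff_ofReal (.of_forall fun x => (Real.exp_pos _).le)]
    refine (lintegral_le_liminf_lintegral_of_forall_isOpen_measure_le_liminf_measure
      (μs := fun n => (scaledLaw (n + 1) : Measure ℝ)) (by fun_prop)
      (fun x => (Real.exp_pos _).le)
      fun G hG => ProbabilityMeasure.le_liminf_measure_open_of_tendsto htend hG).trans_lt ?_
    refine lt_of_le_of_lt (liminf_le_of_frequently_le' (x := ENNReal.ofReal B) ?_)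
      ENNReal.ofReal_lt_top
    refine Eventually.frequently ?_
    filter_upwards [hB] with n hn
    have h := integral_scaledLaw (n + 1) (F := fun x : ℝ => Real.exp (t * |x|)) (by fun_prop)
    rw [← ofReal_integral_eq_lintegral_ofReal h.1 (.of_forall fun x => (Real.exp_pos _).le), h.2]
    refine ENNReal.ofReal_le_ofReal (le_trans (le_of_eq ?_) hn)
    congr 1
    ext x
    rw [abs_of_nonneg (by positivity)]
  have hexp' : ∀ t : ℝ, Integrable (fun x => Real.exp (t * |x|)) (μ : Measure ℝ) := by
    intro t
    refine (hexp |t| (abs_nonneg t)).mono' (by fun_prop) (.of_forall fun x => ?_)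
    rw [Real.norm_of_nonneg (Real.exp_pos _).le]
    gcongr
    exact le_abs_self t
  exact ⟨μ, (tendsto_add_atTop_iff_nat 1).1 htend, moments_of_charFun hexp' hchar⟩

theorem moment_eq (r : ℕ) : (r.factorial : ℝ) * momentCoeff r =
    (r.factorial : ℝ) * limitCoeff r / Real.Gamma ((r : ℝ) * phi + 1) := by
  rw [momentCoeff, mul_div_assoc]

end BinarySaturation
theorem mainTheorem5 :
    -- the exact and the asymptotic formula for the expectation of `L_n`
    (∀ n : ℕ, 1 ≤ n →
      Integrable (fun l : ℕ => (l : ℝ)) (pathLengthLaw n).toMeasure ∧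
      ∫ l : ℕ, (l : ℝ) ∂(pathLengthLaw n).toMeasure =
        n * ((3 + √5) / (2 * √5) * Ring.choose ((n : ℝ) + √5 / 2 - 3 / 2) n
          - (3 - √5) / (2 * √5) * Ring.choose ((n : ℝ) - √5 / 2 - 3 / 2) n)) ∧
    (fun n : ℕ => ∫ l : ℕ, (l : ℝ) ∂(pathLengthLaw n).toMeasure) ~[atTop]
      (fun n : ℕ => (3 + √5) / (2 * √5) * ((n : ℝ) ^ phi / Real.Gamma phi)) ∧
    -- the limit law `μ` of `L_n / n ^ φ`, characterized by its moments
    ∃ (c : ℕ → ℝ) (μ : ProbabilityMeasure ℝ),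
      c 0 = 1 ∧ c 1 = (3 + phi) / 5 ∧
      (∀ r : ℕ, 2 ≤ r →
        c r = 1 / (((r : ℝ) - 1) * phi * (((r : ℝ) + 1) * phi + 1)) *
          ∑ k ∈ Finset.Icc 1 (r - 1), ((k : ℝ) * phi + 1) * c k * c (r - k)) ∧
      TendstoInDistribution (fun (n : ℕ) (l : ℕ) => (l : ℝ) / (n : ℝ) ^ phi) atTop
        (fun x : ℝ => x) (fun n => (pathLengthLaw n).toMeasure) (μ : Measure ℝ) ∧
      (∀ r : ℕ, Integrable (fun x : ℝ => x ^ r) (μ : Measure ℝ) ∧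
        ∫ x, x ^ r ∂(μ : Measure ℝ) =
          (Nat.factorial r : ℝ) * c r / Real.Gamma ((r : ℝ) * phi + 1)) ∧
      (∀ ν : ProbabilityMeasure ℝ,
        (∀ r : ℕ, Integrable (fun x : ℝ => x ^ r) (ν : Measure ℝ) ∧
          ∫ x, x ^ r ∂(ν : Measure ℝ) =
            (Nat.factorial r : ℝ) * c r / Real.Gamma ((r : ℝ) * phi + 1)) →
        ν = μ) := by

  have hmean : ∀ n, ∫ l : ℕ, (l : ℝ) ∂(pathLengthLaw n).toMeasure =
      (urnLaw n).ev fun x => (x.1 : ℝ) + x.2 := fun n => by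
    rw [(integral_pathLengthLaw n _).2]
    push_cast
    rfl
  obtain ⟨μ, hμ, hmom⟩ := exists_limit_law
  refine ⟨fun n hn => ⟨(integral_pathLengthLaw n _).1, ?_⟩, ?_, limitCoeff, μ, limitCoeff_zero,
    limitCoeff_one, limitCoeff_rec, ⟨fun n => (measurable_of_countable _).aemeasurable,
      aemeasurable_id, ?_⟩, fun r => ?_, fun ν hν => ?_⟩
  · rw [hmean, ev_length_eq_choose n hn]
  · simp only [hmean]
    exact isEquivalent_ev_length
  · have hid : (μ : Measure ℝ).map (fun x : ℝ => x) = μ := Measure.map_id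
    have e : (⟨(μ : Measure ℝ).map fun x : ℝ => x,
        Measure.isProbabilityMeasure_map aemeasurable_id⟩ : ProbabilityMeasure ℝ) = μ :=
      Subtype.ext hid
    exact e.symm ▸ hμ
  · rw [← moment_eq]
    exact hmom r
  · refine Subtype.ext (Measure.ext_of_charFun (μ := (ν : Measure ℝ)) (ν := (μ : Measure ℝ)) ?_)
    ext ξ
    rw [charFun_of_moments hmom, charFun_of_moments fun r => by rw [moment_eq]; exact hν r]
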